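/- Digraphs are finite and may have loops and multiple arcs. An embedding of a digraph is a cellular embedding in a connected closed surface. It is a *directed embedding* if every face is bounded by a directed closed walk. For an embedding in an orientable surface with a chosen orientation (an *oriented* embedding), a face bounded by a directed closed walk is a *proface* if this walk is directed clockwise, and an *antiface* if it is directed anticlockwise. Faces are identified with their facial walks, up to cyclic shifts. A *directed euler circuit* is a closed directed walk that uses every arc exactly once and contains every vertex; a digraph is *eulerian* if it has one. A directed embedding is *bi-eulerian* if it has exactly two faces, each bounded by a directed euler circuit. Let $D$ be an eulerian digraph with $n=|V(D)|$ vertices and arc set $A(D)$. Let $\overline D$ be its underlying simple undirected graph: it has vertex set $V(D)$, and two distinct vertices are adjacent in $\overline D$ if and only if some arc of $D$, in either direction, joins them. Suppose that the minimum degree of $\overline D$ satisfies $\delta(\overline D)\ge (4n+2)/5$. Let $T$ be a directed euler circuit of $D$. Then there is an oriented directed embedding $\Phi$ of $D$ such that 1. $T$ is the only proface of $\Phi$; 2. $\Phi$ has exactly one antiface if $|V(D)|+|A(D)|$ is even, and exactly two antifaces if $|V(D)|+|A(D)|$ is odd; 3. $\Phi$ has maximum genus among all orientable directed embeddings of $D$;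 4. if $|V(D)|+|A(D)|$ is even, then $\Phi$ is an orientable bi-eulerian directed embedding of $D$ with $T$ as one of its two faces. -/

import Mathlib

/-- A digraph (loops and multiple arcs allowed) given by half-arcs: `V` is the vertex set, `Out` the
set `A⁺` of outgoing half-arcs, `In` the set `A⁻` of incoming half-arcs.  The arcs are the pairs
`(g, mate g)` with `g : Out`, so that arcs correspond to elements of `Out`. -/
structure HalfArcDigraph (V Out In : Type*) where
  /-- the vertex with which a half-arc is incident -/
  inc : Out ⊕ In → V
  /-- the pairing of outgoing with incoming half-arcs -/
  mate : Out ≃ In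

namespace HalfArcDigraph

variable {V Out In : Type*} (D : HalfArcDigraph V Out In)

/-- The vertex that the arc `(g, mate g)` leaves. -/
def tail (g : Out) : V := D.inc (Sum.inl g)

/-- The vertex that the arc `(g, mate g)` enters. -/
def head (g : Out) : V := D.inc (Sum.inr (D.mate g))

/-- The mate of a half-arc, as an involution of the set `A⁺ ∪ A⁻` of all half-arcs. -/
def matePerm : Equiv.Perm (Out ⊕ In) :=
  (Equiv.sumCongr D.mate D.mate.symm).trans (Equiv.sumComm In Out)

/-- The underlying simple undirected graph: distinct vertices are adjacent if and only if there is
an arc, in either direction, between them. -/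
def underlyingSimpleGraph : SimpleGraph V :=
  SimpleGraph.fromRel fun u v => ∃ g : Out, D.tail g = u ∧ D.head g = v

/-- A nontrivial closed directed walk, up to cyclic shifts, is given by the cyclic sequence of its
arcs: each arc enters the vertex that the next arc leaves. -/
def IsClosedDirectedWalk (C : Cycle Out) : Prop :=
  C ≠ Cycle.nil ∧ C.Chain fun g g' => D.head g = D.tail g'

/-- A (nontrivial) directed euler circuit: a closed directed walk that repeats no arc and contains
all arcs and all vertices. -/
def IsDirectedEulerCircuit (C : Cycle Out) : Prop :=
  D.IsClosedDirectedWalk C ∧ C.Nodup ∧ (∀ g : Out, g ∈ C) ∧ ∀ v : V, ∃ g ∈ C, D.tail g = v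

/-- An oriented cellular embedding, represented by its rotation system: `rot h` is the half-arc that
follows `h` in the clockwise order around the vertex of `h`.  The half-arcs at a vertex form a single
cycle of `rot`. -/
structure OrientedEmbedding where
  /-- the next half-arc in clockwise order around the same vertex -/
  rot : Equiv.Perm (Out ⊕ In)
  sameCycle_iff : ∀ h h' : Out ⊕ In, rot.SameCycle h h' ↔ D.inc h = D.inc h'

namespace OrientedEmbedding

variable {D}
variable (Φ : D.OrientedEmbedding)

/-- Face tracing.  Walk clockwise along the boundary of a face (the face is on the right), leaving a
vertex on the half-arc `h`.  The walk enters the next vertex on the mate of `h`, and leaves it on the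
half-arc that comes just before this mate in the clockwise order. -/
def facePerm : Equiv.Perm (Out ⊕ In) :=
  D.matePerm.trans Φ.rot.symm

/-- The faces are the orbits of face tracing. -/
def Face : Type _ := Quotient (Equiv.Perm.SameCycle.setoid Φ.facePerm)

/-- The face whose clockwise boundary walk leaves a vertex on `h`. -/
def faceOf (h : Out ⊕ In) : Φ.Face := Quotient.mk (Equiv.Perm.SameCycle.setoid Φ.facePerm) h

/-- `c` is the clockwise facial walk of `f`, given as the cyclic sequence of those half-arcs on which
the walk leaves a vertex. -/
def IsFacialWalk (f : Φ.Face) (c : Cycle (Out ⊕ In)) : Prop :=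
  c.Nodup ∧ (c.Chain fun h h' => Φ.facePerm h = h') ∧ ∀ h, h ∈ c ↔ Φ.faceOf h = f

/-- The face `f` is bounded by the closed directed walk `C`, directed clockwise. -/
def BoundedClockwise (f : Φ.Face) (C : Cycle Out) : Prop :=
  D.IsClosedDirectedWalk C ∧ Φ.IsFacialWalk f (C.map Sum.inl)

/-- The face `f` is bounded by the closed directed walk `C`, directed anticlockwise.  The clockwise
facial walk of `f` is the reverse of `C`: it leaves vertices on the incoming half-arcs of the arcs of
`C`, in the reverse order. -/
def BoundedAnticlockwise (f : Φ.Face) (C : Cycle Out) : Prop :=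
  D.IsClosedDirectedWalk C ∧ Φ.IsFacialWalk f (C.map fun g => Sum.inr (D.mate g)).reverse

/-- The face `f` is bounded by the closed directed walk `C`, in one of the two directions. -/
def BoundedBy (f : Φ.Face) (C : Cycle Out) : Prop :=
  Φ.BoundedClockwise f C ∨ Φ.BoundedAnticlockwise f C

/-- A proface is a face whose boundary is a closed directed walk directed clockwise. -/
def IsProface (f : Φ.Face) : Prop := ∃ C, Φ.BoundedClockwise f C

/-- An antiface is a face whose boundary is a closed directed walk directed anticlockwise. -/
def IsAntiface (f : Φ.Face) : Prop := ∃ C, Φ.BoundedAnticlockwise f C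

/-- A directed embedding: every face is bounded by a closed directed walk. -/
def IsDirected : Prop := ∀ f : Φ.Face, ∃ C, Φ.BoundedBy f C

/-- A bi-eulerian directed embedding: there are exactly two faces, and each of them is bounded by a
directed euler circuit. -/
def IsBiEulerian : Prop :=
  Nat.card Φ.Face = 2 ∧ ∀ f : Φ.Face, ∃ C, D.IsDirectedEulerCircuit C ∧ Φ.BoundedBy f C

/-- The genus `γ` of the (orientable) surface, by Euler's formula `|V| - |A| + |F| = 2 - 2γ` for a
finite connected digraph with at least one arc. -/
noncomputable def genus : ℚ :=
  (2 - ((Nat.card V : ℚ) - Nat.card Out + Nat.card Φ.Face)) / 2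

end OrientedEmbedding

end HalfArcDigraph

/-! Let `τ` be the cyclic permutation of the arcs that follows `T`. A permutation `σ` of the arcs
whose cycles are exactly the sets of arcs leaving a common vertex determines a rotation system in
which outgoing and incoming half-arcs alternate at every vertex. Its faces are the cycles of `τ`
(profaces) and those of `σ * τ` (antifaces). So it suffices to choose `σ` such that `σ * τ` has one
or two cycles (`exists_fiberPerm_numCycles`). Parity of permutations decides which of the two
occurs. It also fixes the parity of the number of faces over all embeddings, and a directed
embedding has at least two faces, so two or three faces mean maximum genus.

To find `σ`, keep `σ * τ` a single cycle, written as a cyclic list, and let `σ` start as the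
identity. Exchanging two consecutive segments that are bounded by three arcs with the same tail
multiplies `σ` by a 3-cycle at that vertex and keeps a single cycle. This can fuse three cycles of
`σ` at a vertex (`exists_fuse`), so at most two remain there, and exactly one if the sign of `σ` at
the vertex is that of a full cycle. It remains to correct signs. If `u` and `v` interlace in the
cyclic list, reversing the order of four segments flips the signs at both. When any two vertices can
be flipped, all signs but at most one become right (`exists_reach_sign`). At a last wrong vertex one
transposition joins the two cycles of `σ` and splits `σ * τ` into two.

The degree condition serves only to make every pair flippable (`flippable_of_degree`). The tails of
consecutive arcs on the list always realise all adjacencies. If `u`, `v` cannot be flipped, all `u`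
lie in one block of the cyclic word and all `v` in another, and several patterns with one or two
further vertices are excluded, because 3-cycle moves turn them into an interlacing of `u` and `v`.
In such a `Stuck` word almost all common neighbours of `u` and `v` occur inside both blocks, and
such a `Bad` vertex has too few neighbours: `degree_bad_add_le` leaves only small complete graphs,
which `card_lt_of_complete` excludes. -/

open Equiv Equiv.Perm

/-! ### Cycle counts of permutations, transpositions and parity -/

namespace PermCycles

variable {α : Type*}

/-- The number of cycles of a permutation, fixed points included. -/
noncomputable def numCycles (f : Perm α) : ℕ := Nat.card (Quotient (SameCycle.setoid f))

theorem sameCycle_or_of_swap_mul [Finite α] [DecidableEq α] {f : Perm α} {x y a b : α}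
    (h : SameCycle (swap x y * f) a b) :
    SameCycle f a b ∨
      (SameCycle f x a ∨ SameCycle f y a) ∧ (SameCycle f x b ∨ SameCycle f y b) := by
  obtain ⟨n, rfl⟩ := h.exists_nat_pow_eq
  clear h
  induction n with
  | zero => exact Or.inl (SameCycle.refl _ _)
  | succ n ih =>
    rw [pow_succ', Perm.mul_apply]
    set c := ((swap x y * f) ^ n) a with hc
    have hfc : SameCycle f c (f c) := ⟨1, by simp⟩
    rw [Perm.mul_apply]
    by_cases h1 : f c = x
    · rw [h1, swap_apply_left]
      rw [h1] at hfc
      refine Or.inr ⟨?_, Or.inr (SameCycle.refl _ _)⟩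
      rcases ih with ih | ih
      · exact Or.inl (hfc.symm.trans ih.symm)
      · exact ih.1
    · by_cases h2 : f c = y
      · rw [h2, swap_apply_right]
        rw [h2] at hfc
        refine Or.inr ⟨?_, Or.inl (SameCycle.refl _ _)⟩
        rcases ih with ih | ih
        · exact Or.inr (hfc.symm.trans ih.symm)
        · exact ih.1
      · rw [swap_apply_of_ne_of_ne h1 h2]
        rcases ih with ih | ⟨ih1, ih2⟩
        · exact Or.inl (ih.trans hfc)
        · exact Or.inr ⟨ih1, ih2.imp (·.trans hfc) (·.trans hfc)⟩

/-- The new permutation follows the `f`-orbit of `x` until `f` would return to `x`, and is then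
diverted to `y`. -/
theorem sameCycle_swap_mul_of_not [Finite α] [DecidableEq α] {f : Perm α} {x y : α}
    (h : ¬ SameCycle f x y) : SameCycle (swap x y * f) x y := by
  have key : ∀ n : ℕ, SameCycle (swap x y * f) x ((f ^ n) x) ∨ SameCycle (swap x y * f) x y := by
    intro n
    induction n with
    | zero => exact Or.inl (SameCycle.refl _ _)
    | succ n ih =>
      rcases ih with ih | ih
      · set c := (f ^ n) x with hc
        have hstep : SameCycle (swap x y * f) c (swap x y (f c)) := ⟨1, by simp⟩
        rw [pow_succ', Perm.mul_apply, ← hc]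
        by_cases h1 : f c = x
        · rw [h1, swap_apply_left] at hstep
          exact Or.inr (ih.trans hstep)
        · have h2 : f c ≠ y := by
            intro h2
            exact h ⟨n + 1, by
              rw [← h2, hc, ← Perm.mul_apply, ← pow_succ']; rfl⟩
          rw [swap_apply_of_ne_of_ne h1 h2] at hstep
          exact Or.inl (ih.trans hstep)
      · exact Or.inr ih
  have hx : SameCycle f x (f.symm x) := ⟨-1, by simp⟩
  obtain ⟨n, hn⟩ := hx.exists_nat_pow_eq
  rcases key n with h1 | h1
  · rw [hn] at h1
    exact h1.trans ⟨1, by simp⟩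
  · exact h1

theorem sameCycle_swap_mul_iff [Finite α] [DecidableEq α] {f : Perm α} {x y : α}
    (h : ¬ SameCycle f x y) {a b : α} :
    SameCycle (swap x y * f) a b ↔ SameCycle f a b ∨
      (SameCycle f x a ∨ SameCycle f y a) ∧ (SameCycle f x b ∨ SameCycle f y b) := by
  refine ⟨sameCycle_or_of_swap_mul, ?_⟩
  have hxy := sameCycle_swap_mul_of_not h
  have hsub : ∀ {c d}, SameCycle f c d → SameCycle (swap x y * f) c d := by
    intro c d hcd
    have e : swap x y * (swap x y * f) = f := by rw [← mul_assoc, swap_mul_self, one_mul]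
    rw [← e] at hcd
    rcases sameCycle_or_of_swap_mul hcd with h1 | ⟨h1, h2⟩
    · exact h1
    · have h1' : SameCycle (swap x y * f) x c := h1.elim id hxy.trans
      have h2' : SameCycle (swap x y * f) x d := h2.elim id hxy.trans
      exact h1'.symm.trans h2'
  rintro (h1 | ⟨h1, h2⟩)
  · exact hsub h1
  · have h1' : SameCycle (swap x y * f) x a := h1.elim hsub fun h => hxy.trans (hsub h)
    have h2' : SameCycle (swap x y * f) x b := h2.elim hsub fun h => hxy.trans (hsub h)
    exact h1'.symm.trans h2'

/-- The transposition merges the cycles of `x` and `y` and leaves the others alone, so the old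
cycles other than that of `y` represent the new ones. -/
theorem numCycles_swap_mul [Finite α] [DecidableEq α] {f : Perm α} {x y : α}
    (h : ¬ SameCycle f x y) : numCycles (swap x y * f) + 1 = numCycles f := by
  classical
  let Q := Quotient (SameCycle.setoid f)
  let Q' := Quotient (SameCycle.setoid (swap x y * f))
  let qy : Q := Quotient.mk (SameCycle.setoid f) y
  let F : {q : Q // q ≠ qy} → Q' := fun q =>
    Quotient.map' (s₁ := SameCycle.setoid f) (s₂ := SameCycle.setoid (swap x y * f)) id
      (fun a b hab => (sameCycle_swap_mul_iff h).2 (Or.inl hab)) q.1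
  have hF : Function.Bijective F := by
    constructor
    · rintro ⟨⟨a⟩, ha⟩ ⟨⟨b⟩, hb⟩ hab
      have hab' : SameCycle (swap x y * f) a b := Quotient.exact hab
      have ha' : ¬ SameCycle f y a := fun h' => ha (Quotient.sound h'.symm)
      have hb' : ¬ SameCycle f y b := fun h' => hb (Quotient.sound h'.symm)
      refine Subtype.ext (Quotient.sound ?_)
      rcases sameCycle_or_of_swap_mul hab' with h1 | ⟨h1, h2⟩
      · exact h1
      · exact (h1.resolve_right ha').symm.trans (h2.resolve_right hb')
    · rintro ⟨a⟩
      by_cases ha : SameCycle f y a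
      · refine ⟨⟨Quotient.mk _ x, fun h' => h (Quotient.exact h')⟩, Quotient.sound ?_⟩
        exact (sameCycle_swap_mul_iff h).2 (Or.inr ⟨Or.inl (SameCycle.refl _ _), Or.inr ha⟩)
      · exact ⟨⟨Quotient.mk _ a, fun h' => ha (Quotient.exact h').symm⟩, rfl⟩
  have h1 : Nat.card {q : Q // q ≠ qy} = numCycles (swap x y * f) := Nat.card_eq_of_bijective F hF
  have h2 : Nat.card Q = Nat.card {q : Q // q ≠ qy} + 1 := by
    have := Fintype.ofFinite Q
    rw [Nat.card_eq_fintype_card, Nat.card_eq_fintype_card, Fintype.card_subtype_compl]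
    have : 0 < Fintype.card Q := Fintype.card_pos_iff.2 ⟨qy⟩
    simp
    omega
  rw [← h1]; exact h2.symm

theorem numCycles_eq_one [Nonempty α] {f : Perm α} (h : ∀ a b, SameCycle f a b) :
    numCycles f = 1 := by
  rw [numCycles, Nat.card_eq_one_iff_unique]
  refine ⟨⟨?_⟩, ⟨Quotient.mk _ (Classical.arbitrary α)⟩⟩
  rintro ⟨a⟩ ⟨b⟩
  exact Quotient.sound (h a b)

theorem sameCycle_of_numCycles_le_one [Finite α] {f : Perm α} (h : numCycles f ≤ 1) (a b : α) :
    SameCycle f a b := by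
  have : Subsingleton (Quotient (SameCycle.setoid f)) :=
    Finite.card_le_one_iff_subsingleton.1 h
  exact Quotient.exact (Subsingleton.elim (Quotient.mk (SameCycle.setoid f) a) (Quotient.mk _ b))

theorem sign_of_forall_sameCycle [Fintype α] [DecidableEq α] [Nonempty α] {f : Perm α}
    (h : ∀ a b, SameCycle f a b) : sign f = (-1) ^ (Fintype.card α + 1) := by
  by_cases h1 : ∃ x, f x = x
  · obtain ⟨x, hx⟩ := h1
    have hs : ∀ y, y = x := fun y => ((h x y).eq_of_left hx).symm
    have : Subsingleton α := ⟨fun a b => (hs a).trans (hs b).symm⟩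
    have hf : f = 1 := Subsingleton.elim _ _
    have hc : Fintype.card α = 1 := Fintype.card_eq_one_iff.2 ⟨x, hs⟩
    simp [hf, hc]
  · push Not at h1
    have hcyc : IsCycle f := ⟨Classical.arbitrary α, h1 _, fun y _ => h _ y⟩
    have hsupp : f.support = Finset.univ := by ext y; simp [h1 y]
    rw [hcyc.sign, hsupp, Finset.card_univ, pow_succ]
    simp

/-- Induction on the number of cycles: a transposition across two cycles merges them and changes the
sign, down to a single cycle. -/
theorem sign_eq_numCycles [Fintype α] [DecidableEq α] (f : Perm α) :
    sign f = (-1) ^ (Fintype.card α + numCycles f) := by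
  generalize hn : numCycles f = n
  induction n using Nat.strong_induction_on generalizing f with
  | _ n ih =>
    rcases isEmpty_or_nonempty α with he | he
    · have : n = 0 := by rw [← hn, numCycles, Nat.card_of_isEmpty]
      have hf : f = 1 := Subsingleton.elim _ _
      simp [this, hf]
    · by_cases h : ∀ a b, SameCycle f a b
      · rw [sign_of_forall_sameCycle h, ← hn, numCycles_eq_one h]
      · push Not at h
        obtain ⟨x, y, hxy⟩ := h
        have hne : x ≠ y := fun e => hxy (e ▸ SameCycle.refl _ _)
        have h1 := numCycles_swap_mul hxy
        have h2 := ih (numCycles (swap x y * f)) (by omega) _ rfl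
        rw [Perm.sign_mul, sign_swap hne] at h2
        have : n = numCycles (swap x y * f) + 1 := by omega
        rw [this, ← add_assoc, pow_succ, ← h2]
        simp

theorem even_add_of_neg_one_pow_eq {a b : ℕ} (h : ((-1 : ℤˣ)) ^ a = (-1) ^ b) : Even (a + b) := by
  have h1 : ((-1 : ℤˣ)) ^ (a + b) = 1 := by
    rw [pow_add, h, ← mul_pow]; simp
  by_contra h2
  rw [Nat.not_even_iff_odd] at h2
  rw [h2.neg_one_pow] at h1
  exact absurd h1 (by decide)

/-- Parity constraint on the numbers of cycles of two permutations and their product. -/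
theorem even_numCycles_mul [Finite α] (f g : Perm α) :
    Even (numCycles (f * g) + numCycles f + numCycles g + Nat.card α) := by
  classical
  have := Fintype.ofFinite α
  have h := Perm.sign_mul f g
  rw [sign_eq_numCycles, sign_eq_numCycles f, sign_eq_numCycles g, ← pow_add] at h
  have := even_add_of_neg_one_pow_eq h
  rw [Nat.card_eq_fintype_card]
  rw [Nat.even_iff] at this ⊢
  omega

theorem numCycles_inv (f : Perm α) : numCycles f⁻¹ = numCycles f := by
  unfold numCycles
  congr 1
  have : SameCycle.setoid f⁻¹ = SameCycle.setoid f := by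
    ext a b; exact sameCycle_inv
  rw [this]

/-! ### Cyclic lists -/

theorem nodup_perm_three {x y z : α} {P Q R : List α}
    (h : (x :: P ++ y :: Q ++ z :: R).Nodup) : (x :: P ++ z :: R ++ y :: Q).Nodup := by
  refine (List.Perm.nodup_iff ?_).1 h
  rw [List.append_assoc, List.append_assoc]
  exact List.Perm.append_left _ List.perm_append_comm

theorem nodup_perm_four {a b c d : α} {P Q R S : List α}
    (h : (a :: P ++ c :: Q ++ b :: R ++ d :: S).Nodup) :
    (a :: P ++ d :: S ++ b :: R ++ c :: Q).Nodup := by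
  refine (List.Perm.nodup_iff ?_).1 h
  simp only [List.append_assoc]
  refine List.Perm.append_left _ ?_
  rw [← List.append_assoc, ← List.append_assoc (d :: S)]
  exact List.perm_append_comm.trans
    ((List.Perm.append_left _ List.perm_append_comm).trans (by simp))

variable [DecidableEq α]

/-- A cycle cut into segments is a product of the segment cycles with a permutation of the segment
heads. The exchange identities below follow because the segment cycles commute, so only the factor
on the heads changes. -/
theorem formPerm_cons_append_cons {x y : α} {P Q : List α} (h : (x :: P ++ y :: Q).Nodup) :
    (x :: P ++ y :: Q).formPerm = swap x y * ((x :: P).formPerm * (y :: Q).formPerm) := by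
  induction P generalizing x with
  | nil => simp
  | cons z P ih =>
    have h' : (z :: P ++ y :: Q).Nodup := (List.nodup_cons.1 h).2
    have e : (x :: z :: P ++ y :: Q).formPerm = swap x z * (z :: P ++ y :: Q).formPerm := by
      simp
    rw [e, ih h', List.formPerm_cons_cons]
    have hxy : x ≠ y := by
      rintro rfl
      exact (List.nodup_cons.1 h).1 (by simp)
    have hzy : z ≠ y := by
      rintro rfl
      exact (List.nodup_cons.1 h').1 (by simp)
    have hxz : x ≠ z := by
      rintro rfl
      exact (List.nodup_cons.1 h).1 (by simp)
    rw [← mul_assoc, ← mul_assoc, ← mul_assoc, ← mul_assoc]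
    congr 2
    ext t
    simp only [Perm.mul_apply, swap_apply_def]
    split_ifs <;> simp_all

theorem commute_formPerm {P Q : List α} (h : P.Disjoint Q) :
    Commute P.formPerm Q.formPerm := by
  refine Equiv.Perm.Disjoint.commute fun t => ?_
  by_cases ht : t ∈ P
  · exact Or.inr (List.formPerm_apply_of_notMem (h ht))
  · exact Or.inl (List.formPerm_apply_of_notMem ht)

theorem formPerm_three {x y z : α} {P Q R : List α} (h : (x :: P ++ y :: Q ++ z :: R).Nodup) :
    (x :: P ++ y :: Q ++ z :: R).formPerm = swap x y * swap y z *
      ((x :: P).formPerm * (y :: Q).formPerm * (z :: R).formPerm) := by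
  have h' : (y :: Q ++ z :: R).Nodup := by
    rw [List.append_assoc] at h
    exact (List.nodup_append.1 h).2.1
  have e : x :: P ++ y :: Q ++ z :: R = x :: P ++ y :: (Q ++ z :: R) := by simp
  have e' : y :: (Q ++ z :: R) = y :: Q ++ z :: R := by simp
  rw [e] at h ⊢
  rw [formPerm_cons_append_cons h, e', formPerm_cons_append_cons h']
  have hd : (x :: P).Disjoint [y, z] := by
    intro t ht ht'
    have hd := List.disjoint_of_nodup_append h
    refine hd ht ?_
    simp only [List.mem_cons, List.not_mem_nil, or_false] at ht'
    rcases ht' with rfl | rfl <;> simp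
  have hc := (commute_formPerm hd).eq
  rw [List.formPerm_pair] at hc
  simp only [mul_assoc]
  rw [← mul_assoc (swap y z) (x :: P).formPerm, ← hc]
  simp only [mul_assoc]

/-- Exchanging two segments of a cyclic list multiplies its permutation by a 3-cycle. -/
theorem formPerm_exchange_three {x y z : α} {P Q R : List α}
    (h : (x :: P ++ y :: Q ++ z :: R).Nodup) :
    (x :: P ++ z :: R ++ y :: Q).formPerm =
      swap x z * swap x y * (x :: P ++ y :: Q ++ z :: R).formPerm := by
  have h' := nodup_perm_three h
  rw [formPerm_three h, formPerm_three h']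
  have hd : (y :: Q).Disjoint (z :: R) := by
    rw [List.append_assoc] at h
    exact List.disjoint_of_nodup_append (List.nodup_append.1 h).2.1
  rw [mul_assoc (x :: P).formPerm, mul_assoc (x :: P).formPerm, (commute_formPerm hd).eq]
  rw [← mul_assoc (swap x z * swap x y)]
  congr 1
  rw [mul_assoc, swap_mul_self_mul, swap_comm z y]

theorem formPerm_four {a b c d : α} {P Q R S : List α}
    (h : (a :: P ++ b :: Q ++ c :: R ++ d :: S).Nodup) :
    (a :: P ++ b :: Q ++ c :: R ++ d :: S).formPerm = swap a b * swap b c * swap c d *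
      ((a :: P).formPerm * (b :: Q).formPerm * (c :: R).formPerm * (d :: S).formPerm) := by
  have e : a :: P ++ b :: Q ++ c :: R ++ d :: S = a :: P ++ b :: Q ++ c :: (R ++ d :: S) := by simp
  have e' : c :: (R ++ d :: S) = c :: R ++ d :: S := by simp
  have h' : (c :: R ++ d :: S).Nodup := by
    rw [e, e'] at h
    exact (List.nodup_append.1 h).2.1
  rw [e] at h ⊢
  rw [formPerm_three h, e', formPerm_cons_append_cons h']
  have hd : (a :: P ++ b :: Q).Disjoint [c, d] := by
    intro t ht ht'
    have hd := List.disjoint_of_nodup_append h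
    refine hd ht ?_
    simp only [List.mem_cons, List.not_mem_nil, or_false] at ht'
    rcases ht' with rfl | rfl <;> simp
  have hd1 : (a :: P).Disjoint [c, d] := fun t ht => hd (by simp at ht ⊢; tauto)
  have hd2 : (b :: Q).Disjoint [c, d] := fun t ht => hd (by simp at ht ⊢; tauto)
  have hc1 := (commute_formPerm hd1).eq
  have hc2 := (commute_formPerm hd2).eq
  rw [List.formPerm_pair] at hc1 hc2
  simp only [mul_assoc]
  rw [← mul_assoc (b :: Q).formPerm (swap c d), hc2]
  simp only [mul_assoc]
  rw [← mul_assoc (a :: P).formPerm (swap c d), hc1]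
  simp only [mul_assoc]

theorem swap_identity_four {a b c d : α} (hab : a ≠ b) (hac : a ≠ c) (had : a ≠ d) (hcb : c ≠ b)
    (hcd : c ≠ d) (hbd : b ≠ d) :
    swap a d * swap d b * swap b c =
      swap a b * swap c d * (swap a c * swap c b * swap b d) := by
  have hba := hab.symm
  have hca := hac.symm
  have hda := had.symm
  have hbc := hcb.symm
  have hdc := hcd.symm
  have hdb := hbd.symm
  ext t
  simp only [Perm.mul_apply]
  rcases eq_or_ne t a with rfl | h1
  · simp [swap_apply_of_ne_of_ne, *]
  rcases eq_or_ne t b with rfl | h2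
  · simp [swap_apply_of_ne_of_ne, *]
  rcases eq_or_ne t c with rfl | h3
  · simp [swap_apply_of_ne_of_ne, *]
  rcases eq_or_ne t d with rfl | h4
  · simp [swap_apply_of_ne_of_ne, *]
  simp [swap_apply_of_ne_of_ne, *]

/-- Reversing the order of four segments of a cyclic list multiplies its permutation by two
disjoint transpositions. -/
theorem formPerm_exchange_four {a b c d : α} {P Q R S : List α}
    (h : (a :: P ++ c :: Q ++ b :: R ++ d :: S).Nodup) :
    (a :: P ++ d :: S ++ b :: R ++ c :: Q).formPerm =
      swap a b * swap c d * (a :: P ++ c :: Q ++ b :: R ++ d :: S).formPerm := by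
  have h' := nodup_perm_four h
  rw [formPerm_four h, formPerm_four h']
  have h3 : (c :: Q ++ (b :: R ++ d :: S)).Nodup := by
    simp only [List.append_assoc] at h ⊢
    exact (List.nodup_append.1 h).2.1
  have hd1 := List.disjoint_of_nodup_append h3
  have hd2 := List.disjoint_of_nodup_append (List.nodup_append.1 h3).2.1
  have c1 : Commute (c :: Q).formPerm (b :: R).formPerm :=
    commute_formPerm fun t ht ht' => hd1 ht (by simp at ht' ⊢; tauto)
  have c2 : Commute (c :: Q).formPerm (d :: S).formPerm :=
    commute_formPerm fun t ht ht' => hd1 ht (by simp at ht' ⊢; tauto)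
  have c3 : Commute (b :: R).formPerm (d :: S).formPerm := commute_formPerm hd2
  have e : (c :: Q).formPerm * (b :: R).formPerm * (d :: S).formPerm =
      (d :: S).formPerm * (b :: R).formPerm * (c :: Q).formPerm := by
    rw [c1.eq, mul_assoc, c2.eq, ← mul_assoc, c3.eq]
  have e2 : ∀ f : Perm α, f * (c :: Q).formPerm * (b :: R).formPerm * (d :: S).formPerm =
      f * (d :: S).formPerm * (b :: R).formPerm * (c :: Q).formPerm := by
    intro f
    rw [mul_assoc, mul_assoc, ← mul_assoc (c :: Q).formPerm, e]
    simp only [mul_assoc]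
  rw [e2, ← mul_assoc (swap a b * swap c d)]
  congr 1
  have hab : a ≠ b := by
    rintro rfl; simp at h
  have hac : a ≠ c := by
    rintro rfl; simp at h
  have had : a ≠ d := by
    rintro rfl; simp at h
  have hcb : c ≠ b := by
    rintro rfl; simp at h3
  have hcd : c ≠ d := by
    rintro rfl; simp at h3
  have hbd : b ≠ d := by
    rintro rfl; exact hd2 (List.mem_cons_self) (List.mem_cons_self)
  exact swap_identity_four hab hac had hcb hcd hbd

end PermCycles

/-! ### Fibrewise permutations and moves on cyclic lists -/

namespace PermCycles

variable {X V : Type*}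

/-- The permutation that acts on each fibre of `lab` by a given permutation of this fibre. -/
def fiberPerm (lab : X → V) : (∀ v, Perm {x // lab x = v}) →* Perm X :=
  (sigmaFiberEquiv lab).permCongrHom.toMonoidHom.comp
    (sigmaCongrRightHom fun v => {x // lab x = v})

theorem fiberPerm_apply (lab : X → V) (s : ∀ v, Perm {x // lab x = v}) {v : V}
    (y : {x // lab x = v}) : fiberPerm lab s y = s v y := by
  obtain ⟨y, rfl⟩ := y
  rfl

theorem lab_fiberPerm (lab : X → V) (s : ∀ v, Perm {x // lab x = v}) (x : X) :
    lab (fiberPerm lab s x) = lab x := by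
  rw [fiberPerm_apply lab s (⟨x, rfl⟩ : {y // lab y = lab x})]
  exact (s (lab x) ⟨x, rfl⟩).2

theorem fiberPerm_mulSingle_swap [DecidableEq X] [DecidableEq V] (lab : X → V) {v : V}
    (x y : {x // lab x = v}) :
    fiberPerm lab (Pi.mulSingle v (swap x y)) = swap (x : X) (y : X) := by
  ext t
  rw [fiberPerm_apply lab _ (⟨t, rfl⟩ : {y // lab y = lab t})]
  by_cases ht : lab t = v
  · subst ht
    rw [Pi.mulSingle_eq_same, swap_apply_def, swap_apply_def]
    simp only [Subtype.ext_iff]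
    split_ifs <;> rfl
  · rw [Pi.mulSingle_eq_of_ne ht]
    rw [swap_apply_of_ne_of_ne]
    · rfl
    · rintro rfl; exact ht x.2
    · rintro rfl; exact ht y.2

theorem sameCycle_fiberPerm_iff (lab : X → V) (s : ∀ v, Perm {x // lab x = v}) {v : V}
    (x y : {x // lab x = v}) :
    SameCycle (fiberPerm lab s) (x : X) y ↔ SameCycle (s v) x y := by
  have key : ∀ n : ℤ, (fiberPerm lab s ^ n) (x : X) = ((s v ^ n) x : X) := by
    intro n
    rw [← map_zpow, fiberPerm_apply]
    rfl
  unfold SameCycle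
  simp only [key, Subtype.ext_iff]

/-! ### Cyclic patterns -/

/-- Splits off one marked letter of a pattern. Repeated use cuts a list into the segments that the
moves exchange. -/
theorem exists_of_sublist_map {lab : X → V} {P Q : List V} {w : V} {l : List X}
    (h : (P ++ w :: Q).Sublist (l.map lab)) : ∃ A x B, l = A ++ x :: B ∧ lab x = w ∧
      P.Sublist (A.map lab) ∧ Q.Sublist (B.map lab) := by
  rw [List.append_sublist_iff] at h
  obtain ⟨r₁, r₂, hr, h1, h2⟩ := h
  rw [List.cons_sublist_iff] at h2
  obtain ⟨r₃, r₄, rfl, h3, h4⟩ := h2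
  obtain ⟨s, t, rfl⟩ := List.append_of_mem h3
  rw [List.map_eq_append_iff] at hr
  obtain ⟨l₁, l₂, rfl, e1, e2⟩ := hr
  rw [List.append_assoc, List.map_eq_append_iff] at e2
  obtain ⟨l₃, l₄, rfl, e3, e4⟩ := e2
  rw [List.cons_append, List.map_eq_cons_iff] at e4
  obtain ⟨x, l₅, rfl, hx, e5⟩ := e4
  refine ⟨l₁ ++ l₃, x, l₅, by simp, hx, ?_, ?_⟩
  · rw [List.map_append, e1]
    exact h1.trans (List.sublist_append_left _ _)
  · rw [e5]
    exact h4.trans (List.sublist_append_right _ _)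

/-- `p` is a subsequence of the cyclic sequence of the labels of `l`. -/
def HasPattern (lab : X → V) (l : List X) (p : List V) : Prop :=
  ∃ l', l ~r l' ∧ p.Sublist (l'.map lab)

theorem HasPattern.rotate {lab : X → V} {l : List X} (p q : List V) (h : HasPattern lab l (p ++ q)) :
    HasPattern lab l (q ++ p) := by
  obtain ⟨l', hr, hs⟩ := h
  rw [List.append_sublist_iff] at hs
  obtain ⟨r₁, r₂, e, h1, h2⟩ := hs
  rw [List.map_eq_append_iff] at e
  obtain ⟨l₁, l₂, rfl, rfl, rfl⟩ := e
  refine ⟨l₂ ++ l₁, hr.trans List.isRotated_append, ?_⟩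
  rw [List.map_append]
  exact h2.append h1

theorem HasPattern.sublist {lab : X → V} {l : List X} {p q : List V} (h : HasPattern lab l q)
    (hpq : p.Sublist q) : HasPattern lab l p := by
  obtain ⟨l', hr, hs⟩ := h
  exact ⟨l', hr, hpq.trans hs⟩

/-! ### Moves on cyclic lists -/

variable [Fintype X] [DecidableEq X] [DecidableEq V] (lab : X → V)

/-- `l'` arises from the cyclic list `l` by a permutation that preserves the labels and has sign
`ε v` on the elements with label `v`. -/
def Reach (l l' : List X) (ε : V → ℤˣ) : Prop :=
  l.Perm l' ∧ ∃ s : ∀ v, Perm {x // lab x = v},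
    l'.formPerm = fiberPerm lab s * l.formPerm ∧ ∀ v, sign (s v) = ε v

variable {lab}

theorem Reach.trans {l₁ l₂ l₃ : List X} {ε ε' : V → ℤˣ} (h : Reach lab l₁ l₂ ε)
    (h' : Reach lab l₂ l₃ ε') : Reach lab l₁ l₃ (ε' * ε) := by
  obtain ⟨hp, s, hs, he⟩ := h
  obtain ⟨hp', s', hs', he'⟩ := h'
  refine ⟨hp.trans hp', s' * s, ?_, fun v => ?_⟩
  · rw [hs', hs, map_mul, mul_assoc]
  · rw [Pi.mul_apply, Perm.sign_mul, he, he', Pi.mul_apply]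

theorem Reach.rotate_left {l₁ l₂ l₃ : List X} {ε : V → ℤˣ} (hn : l₁.Nodup) (h : l₁ ~r l₂)
    (h' : Reach lab l₂ l₃ ε) : Reach lab l₁ l₃ ε := by
  obtain ⟨hp, s, hs, he⟩ := h'
  exact ⟨h.perm.trans hp, s, by rw [hs, List.formPerm_eq_of_isRotated hn h], he⟩

theorem sign_mulSingle {v : V} (σ : Perm {x // lab x = v}) (t : V) :
    sign ((Pi.mulSingle v σ : ∀ v, Perm {x // lab x = v}) t) =
      (Pi.mulSingle v (sign σ) : V → ℤˣ) t :=
  Pi.apply_mulSingle (fun t (σ : Perm {x // lab x = t}) => sign σ) (fun _ => Perm.sign_one) v σ t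

/-- The two transpositions lie in the same fibre, so their signs cancel there. -/
theorem reach_exchange_three {x y z : X} {P Q R : List X} (h : (x :: P ++ y :: Q ++ z :: R).Nodup)
    (hy : lab y = lab x) (hz : lab z = lab x) :
    Reach lab (x :: P ++ y :: Q ++ z :: R) (x :: P ++ z :: R ++ y :: Q) 1 := by
  refine ⟨?_, Pi.mulSingle (lab x) (swap ⟨x, rfl⟩ ⟨z, hz⟩) *
    Pi.mulSingle (lab x) (swap ⟨x, rfl⟩ ⟨y, hy⟩), ?_, fun v => ?_⟩
  · rw [List.append_assoc, List.append_assoc]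
    exact List.Perm.append_left _ List.perm_append_comm
  · rw [formPerm_exchange_three h, map_mul, fiberPerm_mulSingle_swap, fiberPerm_mulSingle_swap]
  · have hxy : x ≠ y := by
      rintro rfl; simp at h
    have hxz : x ≠ z := by
      rintro rfl; simp at h
    rw [Pi.mul_apply, Perm.sign_mul, sign_mulSingle, sign_mulSingle, sign_swap, sign_swap,
      ← Pi.mul_apply, ← Pi.mulSingle_mul]
    · simp
    · simpa using hxy
    · simpa using hxz

/-- The sign vector that is `-1` exactly at `u` and `v`. -/
def pairSign (u v : V) : V → ℤˣ := Pi.mulSingle u (-1) * Pi.mulSingle v (-1)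

theorem reach_exchange_four {a b c d : X} {P Q R S : List X}
    (h : (a :: P ++ c :: Q ++ b :: R ++ d :: S).Nodup) (hb : lab b = lab a) (hd : lab d = lab c) :
    Reach lab (a :: P ++ c :: Q ++ b :: R ++ d :: S) (a :: P ++ d :: S ++ b :: R ++ c :: Q)
      (pairSign (lab a) (lab c)) := by
  refine ⟨?_, Pi.mulSingle (lab a) (swap ⟨a, rfl⟩ ⟨b, hb⟩) *
    Pi.mulSingle (lab c) (swap ⟨c, rfl⟩ ⟨d, hd⟩), ?_, fun v => ?_⟩
  · simp only [List.append_assoc]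
    refine List.Perm.append_left _ ?_
    rw [← List.append_assoc, ← List.append_assoc (d :: S)]
    exact List.perm_append_comm.trans
      ((List.Perm.append_left _ List.perm_append_comm).trans (by simp))
  · rw [formPerm_exchange_four h, map_mul, fiberPerm_mulSingle_swap, fiberPerm_mulSingle_swap]
  · have hab : a ≠ b := by
      rintro rfl; simp at h
    have hcd : c ≠ d := by
      rintro rfl
      simp only [List.append_assoc] at h
      have := (List.nodup_append.1 h).2.1
      simp at this
    rw [Pi.mul_apply, Perm.sign_mul, sign_mulSingle, sign_mulSingle, sign_swap, sign_swap,
      ← Pi.mul_apply, pairSign]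
    · simpa using hcd
    · simpa using hab

/-! ### Cyclic patterns -/

/-- The move costs no sign. The pattern after the move is recorded so that an interlacing can be
read off from it. -/
theorem HasPattern.exchange_three {l : List X} (hl : l.Nodup) {w : V} (p q r : List V)
    (h : HasPattern lab l (w :: p ++ w :: q ++ w :: r)) :
    ∃ l', Reach lab l l' 1 ∧ HasPattern lab l' (w :: p ++ w :: r ++ w :: q) := by
  obtain ⟨l', hr, hs⟩ := h
  have e : w :: p ++ w :: q ++ w :: r = [] ++ w :: (p ++ w :: (q ++ w :: r)) := by simp
  rw [e] at hs
  obtain ⟨A, x, B, rfl, hx, -, hs⟩ := exists_of_sublist_map hs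
  obtain ⟨B₁, y, B, rfl, hy, h1, hs⟩ := exists_of_sublist_map hs
  obtain ⟨B₂, z, B₃, rfl, hz, h2, h3⟩ := exists_of_sublist_map hs
  have hr' : l ~r x :: B₁ ++ y :: B₂ ++ z :: (B₃ ++ A) := by
    refine hr.trans ?_
    have := List.isRotated_append (l := A) (l' := x :: B₁ ++ y :: B₂ ++ z :: B₃)
    simpa using this
  have hn := hr'.nodup_iff.1 hl
  subst hx
  refine ⟨_, Reach.rotate_left hl hr' (reach_exchange_three hn hy hz), _, List.IsRotated.refl _, ?_⟩
  simp only [List.map_append, List.map_cons, hy, hz]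
  refine ((h1.cons_cons _).append ?_).append (h2.cons_cons _)
  exact (h3.trans (List.sublist_append_left _ _)).cons_cons _

theorem HasPattern.exchange_four {l : List X} (hl : l.Nodup) {u w : V} (p q r s : List V)
    (h : HasPattern lab l (u :: p ++ w :: q ++ u :: r ++ w :: s)) :
    ∃ l', Reach lab l l' (pairSign u w) := by
  obtain ⟨l', hr, hs⟩ := h
  have e : u :: p ++ w :: q ++ u :: r ++ w :: s =
    [] ++ u :: (p ++ w :: (q ++ u :: (r ++ w :: s))) := by simp
  rw [e] at hs
  obtain ⟨A, a, B, rfl, ha, -, hs⟩ := exists_of_sublist_map hs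
  obtain ⟨B₁, c, B, rfl, hc, h1, hs⟩ := exists_of_sublist_map hs
  obtain ⟨B₂, b, B, rfl, hb, h2, hs⟩ := exists_of_sublist_map hs
  obtain ⟨B₃, d, B₄, rfl, hd, h3, h4⟩ := exists_of_sublist_map hs
  have hr' : l ~r a :: B₁ ++ c :: B₂ ++ b :: B₃ ++ d :: (B₄ ++ A) := by
    refine hr.trans ?_
    have := List.isRotated_append (l := A) (l' := a :: B₁ ++ c :: B₂ ++ b :: B₃ ++ d :: B₄)
    simpa using this
  have hn := hr'.nodup_iff.1 hl
  subst ha hc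
  exact ⟨_, Reach.rotate_left hl hr' (reach_exchange_four hn hb hd)⟩

/-- The signs at `u` and `v` can be flipped. -/
def Flippable (lab : X → V) (l : List X) (u v : V) : Prop :=
  ∃ l', Reach lab l l' (pairSign u v)

theorem Flippable.symm {l : List X} {u v : V} (h : Flippable lab l u v) : Flippable lab l v u := by
  rwa [Flippable, pairSign, mul_comm, ← pairSign]

theorem Flippable.of_reach {l l' : List X} {u v : V} (h : Reach lab l l' 1)
    (h' : Flippable lab l' u v) : Flippable lab l u v := by
  obtain ⟨l'', h''⟩ := h'
  exact ⟨l'', by simpa using h.trans h''⟩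

theorem Reach.nodup {l l' : List X} {ε : V → ℤˣ} (h : Reach lab l l' ε) (hl : l.Nodup) :
    l'.Nodup := (h.1.nodup_iff).1 hl

theorem flippable_of_interlaced {l : List X} (hl : l.Nodup) {u v : V}
    (h : HasPattern lab l [u, v, u, v]) : Flippable lab l u v :=
  HasPattern.exchange_four hl [] [] [] [] h

/-- Read from the first `w`, the word is `w u | w v | w v u`. Exchanging the last two segments gives
`w u w v u w v`, where `u` and `v` interlace. -/
theorem flippable_of_pattern_one {l : List X} (hl : l.Nodup) {u v w : V}
    (h : HasPattern lab l [u, w, u, w, v, w, v]) : Flippable lab l u v := by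
  obtain ⟨l', hr, hp⟩ := HasPattern.exchange_three hl [u] [v] [v, u] (h.rotate [u] _)
  refine .of_reach hr (flippable_of_interlaced (hr.nodup hl) (hp.sublist ?_))
  repeat first
    | exact List.nil_sublist _
    | refine List.Sublist.cons_cons _ ?_
    | refine List.Sublist.cons _ ?_

theorem flippable_of_pattern_two {l : List X} (hl : l.Nodup) {u v w : V}
    (h : HasPattern lab l [u, w, u, v, w, v, w]) : Flippable lab l u v :=
  (flippable_of_pattern_one hl (h.rotate [u, w, u] _)).symm

theorem flippable_of_pattern_three {l : List X} (hl : l.Nodup) {u v w : V}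
    (h : HasPattern lab l [u, w, u, w, u, v, w, v]) : Flippable lab l u v := by
  obtain ⟨l', hr, hp⟩ := HasPattern.exchange_three hl [u] [u, v] [v, u] (h.rotate [u] _)
  refine .of_reach hr (flippable_of_interlaced (hr.nodup hl) (hp.sublist ?_))
  repeat first
    | exact List.nil_sublist _
    | refine List.Sublist.cons_cons _ ?_
    | refine List.Sublist.cons _ ?_

theorem flippable_of_pattern_four {l : List X} (hl : l.Nodup) {u v w : V}
    (h : HasPattern lab l [u, w, u, v, w, v, w, v]) : Flippable lab l u v :=
  (flippable_of_pattern_three hl (h.rotate [u, w, u] _)).symm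

/-- Here and in the next three patterns, a 3-cycle move at `q` creates one of the first two
patterns. -/
theorem flippable_of_pattern_five {l : List X} (hl : l.Nodup) {u v w q : V}
    (h : HasPattern lab l [u, w, q, w, q, u, q, v, w, v]) : Flippable lab l u v := by
  obtain ⟨l', hr, hp⟩ := HasPattern.exchange_three hl [w] [u] [v, w, v, u, w] (h.rotate [u, w] _)
  refine .of_reach hr (flippable_of_pattern_one (w := w) (hr.nodup hl) ((HasPattern.rotate [q, w, q, v, w, v] _ hp).sublist ?_))
  repeat first
    | exact List.nil_sublist _
    | refine List.Sublist.cons_cons _ ?_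
    | refine List.Sublist.cons _ ?_

theorem flippable_of_pattern_six {l : List X} (hl : l.Nodup) {u v w q : V}
    (h : HasPattern lab l [u, w, q, w, q, u, v, w, v, q]) : Flippable lab l u v := by
  obtain ⟨l', hr, hp⟩ := HasPattern.exchange_three hl [w] [u, v, w, v] [u, w] (h.rotate [u, w] _)
  refine .of_reach hr (flippable_of_pattern_two (w := w) (hr.nodup hl) ((HasPattern.rotate [q, w, q] _ hp).sublist ?_))
  repeat first
    | exact List.nil_sublist _
    | refine List.Sublist.cons_cons _ ?_
    | refine List.Sublist.cons _ ?_

theorem flippable_of_pattern_seven {l : List X} (hl : l.Nodup) {u v w q : V}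
    (h : HasPattern lab l [u, q, w, q, w, u, q, v, w, v]) : Flippable lab l u v := by
  obtain ⟨l', hr, hp⟩ := HasPattern.exchange_three hl [w] [w, u] [v, w, v, u] (h.rotate [u] _)
  refine .of_reach hr (flippable_of_pattern_one (w := w) (hr.nodup hl) ((HasPattern.rotate [q, w, q, v, w, v] _ hp).sublist ?_))
  repeat first
    | exact List.nil_sublist _
    | refine List.Sublist.cons_cons _ ?_
    | refine List.Sublist.cons _ ?_

theorem flippable_of_pattern_eight {l : List X} (hl : l.Nodup) {u v w q : V}
    (h : HasPattern lab l [u, q, w, q, w, u, v, w, v, q]) : Flippable lab l u v := by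
  obtain ⟨l', hr, hp⟩ := HasPattern.exchange_three hl [w] [w, u, v, w, v] [u] (h.rotate [u] _)
  refine .of_reach hr (flippable_of_pattern_two (w := w) (hr.nodup hl) ((HasPattern.rotate [q, w, q] _ hp).sublist ?_))
  repeat first
    | exact List.nil_sublist _
    | refine List.Sublist.cons_cons _ ?_
    | refine List.Sublist.cons _ ?_

end PermCycles

/-! ### Letters inside one block of a word -/

namespace PermCycles

section Side

variable {V : Type*}

/-- `x` occurs strictly between the positions `lo` and `hi` of the sequence `L`. -/
def Within (L : ℕ → V) (lo hi : ℕ) (x : V) : Prop := ∃ i, lo < i ∧ i < hi ∧ L i = x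

/-- `x` occurs strictly between the positions `lo` and `hi`, next to `y`. -/
def NextTo (L : ℕ → V) (lo hi : ℕ) (x y : V) : Prop :=
  ∃ i, lo < i ∧ i < hi ∧ L i = x ∧ (L (i + 1) = y ∨ L (i - 1) = y)

/-- No `u` separates two occurrences of `w` between `lo` and `hi`. -/
def OneGap (L : ℕ → V) (lo hi : ℕ) (u w : V) : Prop :=
  ∀ i m j, lo < i → i < m → m < j → j < hi → L i = w → L m = u → L j = w → False

/-- Two occurrences of `w` between `lo` and `hi` do not separate occurrences of `z`. -/
def NotSplit (L : ℕ → V) (lo hi : ℕ) (w z : V) : Prop :=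
  ∀ x y x' y', lo < x → x < y → y < x' → x' < hi → L x = w → L y = z → L x' = w →
    lo < y' → y' < hi → (y' < x ∨ x' < y') → L y' = z → False

/-- `f` and `g` are the first and the last position of `w` between `lo` and `hi`. -/
def IsSpan (L : ℕ → V) (lo hi : ℕ) (w : V) (f g : ℕ) : Prop :=
  lo < f ∧ f ≤ g ∧ g < hi ∧ L f = w ∧ L g = w ∧ ∀ i, lo < i → i < hi → L i = w → f ≤ i ∧ i ≤ g

variable {L : ℕ → V} {lo hi : ℕ} {u w z : V}

theorem pos_ne {i j : ℕ} {x y : V} (hi : L i = x) (hj : L j = y) (h : x ≠ y) : i ≠ j := by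
  rintro rfl; exact h (hi.symm.trans hj)

theorem Within.exists_isSpan (h : Within L lo hi w) : ∃ f g, IsSpan L lo hi w f g := by
  classical
  obtain ⟨i, h1, h2, h3⟩ := h
  let S := (Finset.range hi).filter fun i => lo < i ∧ L i = w
  have hS : S.Nonempty := ⟨i, by simp [S, h1, h2, h3]⟩
  have hmin := S.min'_mem hS
  have hmax := S.max'_mem hS
  simp only [S, Finset.mem_filter, Finset.mem_range] at hmin hmax
  refine ⟨S.min' hS, S.max' hS, hmin.2.1, S.min'_le_max' hS, hmax.1, hmin.2.2, hmax.2.2, ?_⟩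
  intro j h1 h2 h3
  have hj : j ∈ S := by simp [S, h1, h2, h3]
  exact ⟨S.min'_le j hj, S.le_max' j hj⟩

theorem NextTo.within (h : NextTo L lo hi w z) : Within L lo hi w := by
  obtain ⟨i, h1, h2, h3, -⟩ := h
  exact ⟨i, h1, h2, h3⟩

theorem NextTo.within_right (h : NextTo L lo hi w z) (hz : u ≠ z) (hlo : L lo = u)
    (hhi : L hi = u) : Within L lo hi z := by
  obtain ⟨i, h1, h2, -, h4⟩ := h
  rcases h4 with h4 | h4
  · have := pos_ne hhi h4 hz
    exact ⟨i + 1, by omega, by omega, h4⟩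
  · have := pos_ne hlo h4 hz
    exact ⟨i - 1, by omega, by omega, h4⟩

variable {f g : ℕ}

/-- Consider the occurrence of `z` beside a `u`. Inside the span it would put `u` between two `w`,
and outside the span it would be split by `w` from the `z` at `y`. -/
theorem IsSpan.not_inside (hs : IsSpan L lo hi w f g) (hu : u ≠ w) (hg : OneGap L lo hi u w)
    (hsp : NotSplit L lo hi w z) (hzu : NextTo L lo hi z u) {y : ℕ} (h1 : f < y) (h2 : y < g)
    (hy : L y = z) (hzw : z ≠ w) : False := by
  obtain ⟨h3, h4, h5, h6, h7, -⟩ := hs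
  obtain ⟨j, hj1, hj2, hj3, hj4⟩ := hzu
  have e1 := pos_ne hj3 h6 hzw
  have e2 := pos_ne hj3 h7 hzw
  by_cases hj : f < j ∧ j < g
  · rcases hj4 with hj4 | hj4
    · have e3 := pos_ne hj4 h7 hu
      exact hg f (j + 1) g h3 (by omega) (by omega) h5 h6 hj4 h7
    · have e3 := pos_ne hj4 h6 hu
      exact hg f (j - 1) g h3 (by omega) (by omega) h5 h6 hj4 h7
  · exact hsp f y g j h3 h1 h2 h5 h6 hy h7 hj1 hj2 (by omega) hj3

theorem IsSpan.inside_or_outer (hs : IsSpan L lo hi w f g) (hzw : z ≠ w)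
    (h : NextTo L lo hi w z) :
    (∃ y, f < y ∧ y < g ∧ L y = z) ∨ L (f - 1) = z ∨ L (g + 1) = z := by
  obtain ⟨h3, h4, h5, h6, h7, h8⟩ := hs
  obtain ⟨i, i1, i2, i3, i4⟩ := h
  obtain ⟨h9, h10⟩ := h8 i i1 i2 i3
  rcases i4 with i4 | i4
  · rcases h10.eq_or_lt with rfl | h10
    · exact Or.inr (Or.inr i4)
    · have := pos_ne i4 h7 hzw
      exact Or.inl ⟨i + 1, by omega, by omega, i4⟩
  · rcases h9.eq_or_lt with rfl | h9
    · exact Or.inr (Or.inl i4)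
    · have := pos_ne i4 h6 hzw
      exact Or.inl ⟨i - 1, by omega, by omega, i4⟩

theorem IsSpan.outer (hs : IsSpan L lo hi w f g) (hu : u ≠ w) (hg : OneGap L lo hi u w)
    (hsp : NotSplit L lo hi w z) (hzu : NextTo L lo hi z u) (hzw : z ≠ w)
    (h : NextTo L lo hi w z) : L (f - 1) = z ∨ L (g + 1) = z := by
  rcases hs.inside_or_outer hzw h with ⟨y, h1, h2, hy⟩ | h
  · exact (hs.not_inside hu hg hsp hzu h1 h2 hy hzw).elim
  · exact h

theorem IsSpan.outer_center (hs : IsSpan L lo hi w f g) (hu : u ≠ w) (hg : OneGap L lo hi u w)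
    (h : NextTo L lo hi w u) : L (f - 1) = u ∨ L (g + 1) = u := by
  rcases hs.inside_or_outer hu h with ⟨y, h1, h2, hy⟩ | h
  · obtain ⟨h3, h4, h5, h6, h7, -⟩ := hs
    exact (hg f y g h3 h1 h2 h5 h6 hy h7).elim
  · exact h

/-- The span of `w` has only two outer neighbours. One of them is `u`, and both `z₁` and `z₂` must
be outer neighbours too, so they share the other. -/
theorem eq_of_nextTo {z₁ z₂ : V} (hu : u ≠ w) (hg : OneGap L lo hi u w) (hwu : NextTo L lo hi w u)
    (hs₁ : NotSplit L lo hi w z₁) (hs₂ : NotSplit L lo hi w z₂) (hu₁ : NextTo L lo hi z₁ u)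
    (hu₂ : NextTo L lo hi z₂ u) (hw₁ : NextTo L lo hi w z₁) (hw₂ : NextTo L lo hi w z₂)
    (h₁ : z₁ ≠ w) (h₂ : z₂ ≠ w) (h₁' : z₁ ≠ u) (h₂' : z₂ ≠ u) : z₁ = z₂ := by
  obtain ⟨f, g, hs⟩ := hwu.within.exists_isSpan
  have a1 := hs.outer hu hg hs₁ hu₁ h₁ hw₁
  have a2 := hs.outer hu hg hs₂ hu₂ h₂ hw₂
  have a3 := hs.outer_center hu hg hwu
  grind

/-- Somewhere `w₁` and `w₂` are consecutive, and that pair lies on one side of `m`. If `m` separated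
`p` from `q`, it would separate two occurrences of `w₁` or two of `w₂`. -/
theorem not_separated {w₁ w₂ : V} (h₁ : w₁ ≠ u) (h₂ : w₂ ≠ u) (hg₁ : OneGap L lo hi u w₁)
    (hg₂ : OneGap L lo hi u w₂) (hlo : L lo = u) (hhi : L hi = u) (h : NextTo L lo hi w₁ w₂)
    {p q m : ℕ} (p1 : lo < p) (p2 : p < hi) (q1 : lo < q) (q2 : q < hi) (hp : L p = w₁)
    (hq : L q = w₂) (hm : L m = u) : ¬ (p < m ∧ m < q) ∧ ¬ (q < m ∧ m < p) := by
  obtain ⟨i, i1, i2, i3, i4⟩ := h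
  obtain ⟨k, k1, k2, k3, k4⟩ : ∃ k, lo < k ∧ k < hi ∧ L k = w₂ ∧ (k = i + 1 ∨ k = i - 1) := by
    rcases i4 with i4 | i4
    · have := pos_ne hhi i4 h₂.symm
      exact ⟨i + 1, by omega, by omega, i4, Or.inl rfl⟩
    · have := pos_ne hlo i4 h₂.symm
      exact ⟨i - 1, by omega, by omega, i4, Or.inr rfl⟩
  have e1 := pos_ne hm i3 h₁.symm
  have e2 := pos_ne hm k3 h₂.symm
  constructor
  · rintro ⟨m1, m2⟩
    rcases lt_or_gt_of_ne e1 with e | e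
    · exact hg₁ p m i p1 m1 e i2 hp hm i3
    · exact hg₂ k m q k1 (by omega) m2 q2 k3 hm hq
  · rintro ⟨m1, m2⟩
    rcases lt_or_gt_of_ne e1 with e | e
    · exact hg₂ q m k q1 m1 (by omega) k2 hq hm k3
    · exact hg₁ i m p i1 e m2 p2 i3 hm hp

/-- If both positions were followed by `u`, the `u` after the earlier one would separate them. The
same holds for preceding `u`. -/
theorem not_same_side {p q : ℕ} {x y : V} (hp : L p = x) (hq : L q = y) (hx : x ≠ u) (hy : y ≠ u)
    (hpq : p ≠ q) (lp : lo < p) (lq : lo < q)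
    (hm : ∀ m, L m = u → ¬ (p < m ∧ m < q) ∧ ¬ (q < m ∧ m < p)) :
    ¬ (L (p + 1) = u ∧ L (q + 1) = u) ∧ ¬ (L (p - 1) = u ∧ L (q - 1) = u) := by
  constructor
  · rintro ⟨a, b⟩
    have h1 := hm _ a
    have h2 := hm _ b
    have h3 := pos_ne a hq hy.symm
    have h4 := pos_ne b hp hx.symm
    omega
  · rintro ⟨a, b⟩
    have h1 := hm _ a
    have h2 := hm _ b
    have h3 := pos_ne a hq hy.symm
    have h4 := pos_ne b hp hx.symm
    omega

/-- All three letters lie in the same gap between consecutive `u`, and each stands at an end of this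
gap, which has only two ends. -/
theorem no_three_nextTo {w₁ w₂ w₃ : V} (h₁ : w₁ ≠ u) (h₂ : w₂ ≠ u) (h₃ : w₃ ≠ u)
    (h12 : w₁ ≠ w₂) (h13 : w₁ ≠ w₃) (h23 : w₂ ≠ w₃)
    (hg₁ : OneGap L lo hi u w₁) (hg₂ : OneGap L lo hi u w₂) (hg₃ : OneGap L lo hi u w₃)
    (hu₁ : NextTo L lo hi w₁ u) (hu₂ : NextTo L lo hi w₂ u) (hu₃ : NextTo L lo hi w₃ u)
    (hlo : L lo = u) (hhi : L hi = u)
    (a2 : NextTo L lo hi w₁ w₂) (a3 : NextTo L lo hi w₁ w₃) : False := by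
  obtain ⟨p, p1, p2, p3, p4⟩ := hu₁
  obtain ⟨q, q1, q2, q3, q4⟩ := hu₂
  obtain ⟨r, r1, r2, r3, r4⟩ := hu₃
  have pq := fun m => not_separated h₁ h₂ hg₁ hg₂ hlo hhi a2 p1 p2 q1 q2 p3 q3 (m := m)
  have pr := fun m => not_separated h₁ h₃ hg₁ hg₃ hlo hhi a3 p1 p2 r1 r2 p3 r3 (m := m)
  have qr : ∀ m, L m = u → ¬ (q < m ∧ m < r) ∧ ¬ (r < m ∧ m < q) := by
    intro m hm
    have h1 := pq m hm
    have h2 := pr m hm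
    have h3 := pos_ne hm p3 h₁.symm
    omega
  have s1 := not_same_side p3 q3 h₁ h₂ (pos_ne p3 q3 h12) p1 q1 pq
  have s2 := not_same_side p3 r3 h₁ h₃ (pos_ne p3 r3 h13) p1 r1 pr
  have s3 := not_same_side q3 r3 h₂ h₃ (pos_ne q3 r3 h23) q1 r1 qr
  rcases p4 with p4 | p4 <;> rcases q4 with q4 | q4 <;> rcases r4 with r4 | r4 <;> first
    | exact s1.1 ⟨p4, q4⟩
    | exact s1.2 ⟨p4, q4⟩
    | exact s2.1 ⟨p4, r4⟩
    | exact s2.2 ⟨p4, r4⟩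
    | exact s3.1 ⟨q4, r4⟩
    | exact s3.2 ⟨q4, r4⟩

/-- The outer neighbours of both spans are `u` and `z₁`, so `z₂` meets `w` and `w'` inside their
spans. Since `w'` does not split `z₂`, an occurrence of `z₂` lies in both spans, which therefore
overlap. Then the letter before the later start, `u` or `z₁`, lies inside the other span, where
neither may occur. -/
theorem no_two_nextTo_two {w' z₁ z₂ : V} (hww : w ≠ w') (hu : u ≠ w) (hu' : u ≠ w')
    (hg : OneGap L lo hi u w) (hg' : OneGap L lo hi u w')
    (hwu : NextTo L lo hi w u) (hwu' : NextTo L lo hi w' u) (hz : z₁ ≠ z₂)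
    (h₁ : z₁ ≠ w) (h₂ : z₂ ≠ w) (h₁' : z₁ ≠ w') (h₂' : z₂ ≠ w') (h₁u : z₁ ≠ u) (h₂u : z₂ ≠ u)
    (hs₁ : NotSplit L lo hi w z₁)
    (hs₁' : NotSplit L lo hi w' z₁) (hs₂' : NotSplit L lo hi w' z₂) (hz₁ : NextTo L lo hi z₁ u)
    (a₁ : NextTo L lo hi w z₁) (a₂ : NextTo L lo hi w z₂)
    (a₁' : NextTo L lo hi w' z₁) (a₂' : NextTo L lo hi w' z₂) : False := by
  obtain ⟨f, g, hs⟩ := hwu.within.exists_isSpan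
  obtain ⟨f', g', hs'⟩ := hwu'.within.exists_isSpan
  have b1 := hs.outer hu hg hs₁ hz₁ h₁ a₁
  have b2 := hs.outer_center hu hg hwu
  have b1' := hs'.outer hu' hg' hs₁' hz₁ h₁' a₁'
  have b2' := hs'.outer_center hu' hg' hwu'
  have b3 := (hs.inside_or_outer h₂ a₂).resolve_right (by grind)
  have b3' := (hs'.inside_or_outer h₂' a₂').resolve_right (by grind)
  have c := fun y => hs.not_inside (y := y) hu hg hs₁ hz₁
  have c' := fun y => hs'.not_inside (y := y) hu' hg' hs₁' hz₁
  obtain ⟨s1, s2, s3, s4, s5, -⟩ := hs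
  obtain ⟨s1', s2', s3', s4', s5', -⟩ := hs'
  obtain ⟨y, y1, y2, y3⟩ := b3
  obtain ⟨y', y1', y2', y3'⟩ := b3'
  have e1 := pos_ne y3 s4' h₂'
  have e2 := pos_ne y3 s5' h₂'
  have hy : f' < y ∧ y < g' := by
    by_contra hcon
    exact hs₂' f' y' g' y s1' y1' y2' s3' s4' y3' s5' (by omega) (by omega) (by omega) y3
  have n1 := pos_ne s4 s4' hww
  have n2 := pos_ne s5 s5' hww
  have n3 := pos_ne s4 s5' hww
  have n4 := pos_ne s5 s4' hww
  -- an outer neighbour of one span that lies inside the other span is impossible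
  have d : ∀ m, f < m → m < g → ¬ (L m = u ∨ L m = z₁) := by
    rintro m m1 m2 (hm | hm)
    · exact hg f m g s1 m1 m2 s3 s4 hm s5
    · exact c m m1 m2 hm h₁
  have d' : ∀ m, f' < m → m < g' → ¬ (L m = u ∨ L m = z₁) := by
    rintro m m1 m2 (hm | hm)
    · exact hg' f' m g' s1' m1 m2 s3' s4' hm s5'
    · exact c' m m1 m2 hm h₁'
  have o1 : L (f - 1) = u ∨ L (f - 1) = z₁ := by grind
  have o1' : L (f' - 1) = u ∨ L (f' - 1) = z₁ := by grind
  rcases lt_or_gt_of_ne n1 with h | h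
  · have m1 : f' - 1 ≠ f := by
      intro e
      rw [e, s4] at o1'
      rcases o1' with o | o
      · exact hu o.symm
      · exact h₁ o.symm
    exact d (f' - 1) (by omega) (by omega) o1'
  · have m1 : f - 1 ≠ f' := by
      intro e
      rw [e, s4'] at o1
      rcases o1 with o | o
      · exact hu' o.symm
      · exact h₁' o.symm
    exact d' (f - 1) (by omega) (by omega) o1

end Side

end PermCycles

/-! ### Stuck words and their bad vertices -/

namespace PermCycles

variable {V : Type*}

/-- `z` occurs in the word `L` of length `N` neither between `0` and `a` nor between `b` and `c`. -/
def Outside (L : ℕ → V) (N a b c : ℕ) (z : V) : Prop :=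
  ∃ i, ((a < i ∧ i < b) ∨ (c < i ∧ i < N)) ∧ L i = z

/-- A cyclic word, written from position `0` to position `N`, that contains all adjacencies of `G`,
has all `u` up to position `a`, all `v` between the positions `b` and `c`, and has none of the
patterns by which the signs at `u` and `v` could be flipped. -/
structure Stuck (G : SimpleGraph V) (L : ℕ → V) (N a b c : ℕ) (u v : V) : Prop where
  huv : u ≠ v
  hab : a < b
  hbc : b ≤ c
  hcN : c < N
  h0 : L 0 = u
  ha : L a = u
  hb : L b = v
  hc : L c = v
  hN : L N = u
  hu : ∀ i < N, L i = u → i ≤ a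
  hv : ∀ i < N, L i = v → b ≤ i ∧ i ≤ c
  hadj : ∀ x y, G.Adj x y → ∃ i < N, (L i = x ∧ L (i + 1) = y) ∨ (L i = y ∧ L (i + 1) = x)
  hout : ∀ w, Within L 0 a w → Within L b c w → ¬ Outside L N a b c w
  hgapA : ∀ w, Within L b c w → OneGap L 0 a u w
  hgapB : ∀ w, Within L 0 a w → OneGap L b c v w
  hsplitA : ∀ w z, Within L b c w → Outside L N a b c z → NotSplit L 0 a w z
  hsplitB : ∀ w z, Within L 0 a w → Outside L N a b c z → NotSplit L b c w z

namespace Stuck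

/-- Common neighbours of `u` and `v` that occur in both blocks of the word. -/
structure Bad (G : SimpleGraph V) (L : ℕ → V) (a b c : ℕ) (u v w : V) : Prop where
  adju : G.Adj u w
  adjv : G.Adj v w
  inA : Within L 0 a w
  inB : Within L b c w

variable {G : SimpleGraph V} {L : ℕ → V} {N a b c : ℕ} {u v w z : V}
section Sets

variable [Fintype V]

open Classical in
/-- The common neighbours of `u` and `v` that do not occur between `lo` and `hi`. -/
noncomputable def missing (G : SimpleGraph V) (L : ℕ → V) (lo hi : ℕ) (u v : V) : Finset V :=
  Finset.univ.filter fun z => G.Adj u z ∧ G.Adj v z ∧ ¬ Within L lo hi z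

open Classical in
/-- The finite set of bad vertices. -/
noncomputable def badSet (G : SimpleGraph V) (L : ℕ → V) (a b c : ℕ) (u v : V) : Finset V :=
  Finset.univ.filter fun z => Bad G L a b c u v z

theorem mem_missing {lo hi : ℕ} :
    z ∈ missing G L lo hi u v ↔ G.Adj u z ∧ G.Adj v z ∧ ¬ Within L lo hi z := by
  simp [missing]

theorem mem_badSet : z ∈ badSet G L a b c u v ↔ Bad G L a b c u v z := by
  simp [badSet]

theorem degree_add_le [DecidableEq V] [DecidableRel G.Adj] : G.degree u + G.degree v ≤
    (G.neighborFinset u ∩ G.neighborFinset v).card + Fintype.card V := by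
  rw [← SimpleGraph.card_neighborFinset_eq_degree, ← SimpleGraph.card_neighborFinset_eq_degree,
    ← Finset.card_union_add_card_inter, add_comm]
  exact Nat.add_le_add_left (Finset.card_le_univ _) _

theorem common_subset [DecidableEq V] [DecidableRel G.Adj] : G.neighborFinset u ∩ G.neighborFinset v ⊆
    badSet G L a b c u v ∪ (missing G L 0 a u v ∪ missing G L b c u v) := by
  intro z hz
  simp only [Finset.mem_inter, SimpleGraph.mem_neighborFinset] at hz
  simp only [Finset.mem_union, mem_missing, mem_badSet]
  by_cases h1 : Within L 0 a z
  · by_cases h2 : Within L b c z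
    · exact Or.inl ⟨hz.1, hz.2, h1, h2⟩
    · exact Or.inr (Or.inr ⟨hz.1, hz.2, h2⟩)
  · exact Or.inr (Or.inl ⟨hz.1, hz.2, h1⟩)

end Sets

variable (S : Stuck G L N a b c u v)
include S

theorem outside_alpha (hzu : z ≠ u) (hzv : z ≠ v) (h : z = L (a + 1) ∨ z = L (N - 1)) :
    Outside L N a b c z := by
  have := S.hab
  have := S.hbc
  have := S.hcN
  rcases h with rfl | rfl
  · have := pos_ne S.hb rfl hzv.symm
    exact ⟨a + 1, by omega, rfl⟩
  · have := pos_ne S.hc rfl hzv.symm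
    exact ⟨N - 1, by omega, rfl⟩

theorem outside_beta (hzu : z ≠ u) (hzv : z ≠ v) (h : z = L (b - 1) ∨ z = L (c + 1)) :
    Outside L N a b c z := by
  have := S.hab
  have := S.hbc
  have := S.hcN
  rcases h with rfl | rfl
  · have := pos_ne S.ha rfl hzu.symm
    exact ⟨b - 1, by omega, rfl⟩
  · have := pos_ne S.hN rfl hzu.symm
    exact ⟨c + 1, by omega, rfl⟩

/-- Every `u` lies in the first block, so an adjacency at `u` leaves this block only after position
`a` or before the closing position `N`. -/
theorem nextTo_or_alpha (hzu : z ≠ u) (h : G.Adj u z) :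
    NextTo L 0 a z u ∨ z = L (a + 1) ∨ z = L (N - 1) := by
  have := S.hab
  have := S.hbc
  have := S.hcN
  obtain ⟨i, hi, ⟨h1, h2⟩ | ⟨h1, h2⟩⟩ := S.hadj _ _ h
  · have := S.hu i hi h1
    rcases eq_or_ne i a with rfl | hne
    · exact Or.inr (Or.inl h2.symm)
    · have := pos_ne S.ha h2 hzu.symm
      exact Or.inl ⟨i + 1, by omega, by omega, h2, Or.inr h1⟩
  · rcases eq_or_ne (i + 1) N with e | hne
    · exact Or.inr (Or.inr (by rw [← h1, ← e]; rfl))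
    · have := S.hu (i + 1) (by omega) h2
      have := pos_ne S.h0 h1 hzu.symm
      exact Or.inl ⟨i, by omega, by omega, h1, Or.inl h2⟩

theorem nextTo_or_beta (hzv : z ≠ v) (h : G.Adj v z) :
    NextTo L b c z v ∨ z = L (b - 1) ∨ z = L (c + 1) := by
  have := S.hab
  have := S.hbc
  have := S.hcN
  obtain ⟨i, hi, ⟨h1, h2⟩ | ⟨h1, h2⟩⟩ := S.hadj _ _ h
  · have := S.hv i hi h1
    rcases eq_or_ne i c with rfl | hne
    · exact Or.inr (Or.inr h2.symm)
    · have := pos_ne S.hc h2 hzv.symm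
      exact Or.inl ⟨i + 1, by omega, by omega, h2, Or.inr h1⟩
  · have := pos_ne S.hN h2 S.huv
    have := S.hv (i + 1) (by omega) h2
    rcases eq_or_ne (i + 1) b with e | hne
    · exact Or.inr (Or.inl (by rw [← h1, ← e]; rfl))
    · have := pos_ne S.hb h1 hzv.symm
      exact Or.inl ⟨i, by omega, by omega, h1, Or.inl h2⟩

theorem within_of_nextTo_left (hzu : z ≠ u) (h : NextTo L 0 a w z) : Within L 0 a z :=
  h.within_right hzu.symm S.h0 S.ha

theorem within_of_nextTo_right (hzv : z ≠ v) (h : NextTo L b c w z) : Within L b c z :=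
  h.within_right hzv.symm S.hb S.hc

theorem nextTo_of_adj (hwu : w ≠ u) (hwv : w ≠ v) (hA : Within L 0 a w) (hB : Within L b c w)
    (h : G.Adj w z) : NextTo L 0 a w z ∨ NextTo L b c w z := by
  have hno := S.hout w hA hB
  have := S.hab
  have := S.hbc
  have := S.hcN
  have key : ∀ i < N, L i = w → (0 < i ∧ i < a) ∨ (b < i ∧ i < c) := by
    intro i hi h1
    have h2 : ¬ ((a < i ∧ i < b) ∨ (c < i ∧ i < N)) := fun h2 => hno ⟨i, h2, h1⟩
    have := pos_ne S.h0 h1 hwu.symm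
    have := pos_ne S.ha h1 hwu.symm
    have := pos_ne S.hb h1 hwv.symm
    have := pos_ne S.hc h1 hwv.symm
    omega
  obtain ⟨i, hi, ⟨h1, h2⟩ | ⟨h1, h2⟩⟩ := S.hadj _ _ h
  · rcases key i hi h1 with h3 | h3
    · exact Or.inl ⟨i, h3.1, h3.2, h1, Or.inl h2⟩
    · exact Or.inr ⟨i, h3.1, h3.2, h1, Or.inl h2⟩
  · have := pos_ne S.hN h2 hwu.symm
    rcases key (i + 1) (by omega) h2 with h3 | h3
    · exact Or.inl ⟨i + 1, h3.1, h3.2, h2, Or.inr h1⟩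
    · exact Or.inr ⟨i + 1, h3.1, h3.2, h2, Or.inr h1⟩

/-- Were `w` at an end outside the block, it would occur in both blocks and outside them, which
`hout` forbids. -/
theorem bad_nextTo_left (h : Bad G L a b c u v w) : NextTo L 0 a w u :=
  (S.nextTo_or_alpha h.adju.ne' h.adju).resolve_right fun h' =>
    S.hout w h.inA h.inB (S.outside_alpha h.adju.ne' h.adjv.ne' h')

theorem bad_nextTo_right (h : Bad G L a b c u v w) : NextTo L b c w v :=
  (S.nextTo_or_beta h.adjv.ne' h.adjv).resolve_right fun h' =>
    S.hout w h.inA h.inB (S.outside_beta h.adju.ne' h.adjv.ne' h')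

theorem bad_adj (h : Bad G L a b c u v w) (hz : G.Adj w z) :
    NextTo L 0 a w z ∨ NextTo L b c w z :=
  S.nextTo_of_adj h.adju.ne' h.adjv.ne' h.inA h.inB hz

theorem no_three_left {w₁ w₂ w₃ : V} (b₁ : Bad G L a b c u v w₁) (b₂ : Bad G L a b c u v w₂)
    (b₃ : Bad G L a b c u v w₃) (h12 : w₁ ≠ w₂) (h13 : w₁ ≠ w₃) (h23 : w₂ ≠ w₃)
    (a2 : NextTo L 0 a w₁ w₂) (a3 : NextTo L 0 a w₁ w₃) : False :=
  no_three_nextTo b₁.adju.ne' b₂.adju.ne' b₃.adju.ne' h12 h13 h23 (S.hgapA _ b₁.inB)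
    (S.hgapA _ b₂.inB) (S.hgapA _ b₃.inB) (S.bad_nextTo_left b₁) (S.bad_nextTo_left b₂)
    (S.bad_nextTo_left b₃) S.h0 S.ha a2 a3

theorem no_three_right {w₁ w₂ w₃ : V} (b₁ : Bad G L a b c u v w₁) (b₂ : Bad G L a b c u v w₂)
    (b₃ : Bad G L a b c u v w₃) (h12 : w₁ ≠ w₂) (h13 : w₁ ≠ w₃) (h23 : w₂ ≠ w₃)
    (a2 : NextTo L b c w₁ w₂) (a3 : NextTo L b c w₁ w₃) : False :=
  no_three_nextTo b₁.adjv.ne' b₂.adjv.ne' b₃.adjv.ne' h12 h13 h23 (S.hgapB _ b₁.inA)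
    (S.hgapB _ b₂.inA) (S.hgapB _ b₃.inA) (S.bad_nextTo_right b₁) (S.bad_nextTo_right b₂)
    (S.bad_nextTo_right b₃) S.hb S.hc a2 a3

/-- Each edge is realised in one of the two blocks, so two of the three edges share a block, and
they share a vertex. -/
theorem no_triangle {w₁ w₂ w₃ : V} (b₁ : Bad G L a b c u v w₁) (b₂ : Bad G L a b c u v w₂)
    (b₃ : Bad G L a b c u v w₃) (h12 : G.Adj w₁ w₂) (h13 : G.Adj w₁ w₃) (h23 : G.Adj w₂ w₃) :
    False := by
  have swapL : ∀ {x y}, NextTo L 0 a x y → y ≠ u → NextTo L 0 a y x := by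
    rintro x y ⟨i, h1, h2, h3, h4 | h4⟩ hy
    · have := pos_ne S.ha h4 hy.symm
      exact ⟨i + 1, by omega, by omega, h4, Or.inr h3⟩
    · have := pos_ne S.h0 h4 hy.symm
      exact ⟨i - 1, by omega, by omega, h4, Or.inl (by rwa [Nat.sub_add_cancel h1])⟩
  have swapR : ∀ {x y}, NextTo L b c x y → y ≠ v → NextTo L b c y x := by
    rintro x y ⟨i, h1, h2, h3, h4 | h4⟩ hy
    · have := pos_ne S.hc h4 hy.symm
      exact ⟨i + 1, by omega, by omega, h4, Or.inr h3⟩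
    · have := pos_ne S.hb h4 hy.symm
      exact ⟨i - 1, by omega, by omega, h4, Or.inl (by rwa [Nat.sub_add_cancel (by omega)])⟩
  rcases S.bad_adj b₁ h12 with e1 | e1 <;> rcases S.bad_adj b₁ h13 with e2 | e2 <;>
    rcases S.bad_adj b₂ h23 with e3 | e3
  · exact S.no_three_left b₁ b₂ b₃ h12.ne h13.ne h23.ne e1 e2
  · exact S.no_three_left b₁ b₂ b₃ h12.ne h13.ne h23.ne e1 e2
  · exact S.no_three_left b₂ b₁ b₃ h12.ne' h23.ne h13.ne (swapL e1 b₂.adju.ne') e3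
  · exact S.no_three_right b₃ b₁ b₂ h13.ne' h23.ne' h12.ne (swapR e2 b₃.adjv.ne')
      (swapR e3 b₃.adjv.ne')
  · exact S.no_three_left b₃ b₁ b₂ h13.ne' h23.ne' h12.ne (swapL e2 b₃.adju.ne')
      (swapL e3 b₃.adju.ne')
  · exact S.no_three_right b₂ b₁ b₃ h12.ne' h23.ne h13.ne (swapR e1 b₂.adjv.ne') e3
  · exact S.no_three_right b₁ b₂ b₃ h12.ne h13.ne h23.ne e1 e2
  · exact S.no_three_right b₁ b₂ b₃ h12.ne h13.ne h23.ne e1 e2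

/-! ### Degree counting in a stuck word -/

section Counting

variable [Fintype V]

theorem nextTo_left_of_missing (hw : Bad G L a b c u v w) (hz : z ∈ missing G L b c u v)
    (h : G.Adj w z) : NextTo L 0 a w z := by
  rw [mem_missing] at hz
  exact (S.bad_adj hw h).resolve_right fun h' =>
    hz.2.2 (S.within_of_nextTo_right hz.2.1.ne' h')

theorem nextTo_right_of_missing (hw : Bad G L a b c u v w) (hz : z ∈ missing G L 0 a u v)
    (h : G.Adj w z) : NextTo L b c w z := by
  rw [mem_missing] at hz
  exact (S.bad_adj hw h).resolve_left fun h' =>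
    hz.2.2 (S.within_of_nextTo_left hz.1.ne' h')

theorem notMem_missing_left (hw : Bad G L a b c u v w) (hz : z ∈ missing G L b c u v)
    (h : G.Adj w z) : z ∉ missing G L 0 a u v := by
  intro h'
  have := S.nextTo_left_of_missing hw hz h
  rw [mem_missing] at hz h'
  exact h'.2.2 (S.within_of_nextTo_left hz.1.ne' this)

/-- Each block can realise the adjacency of `w` with at most one bad vertex. -/
theorem card_bad_adj_le [DecidableRel G.Adj] (hw : Bad G L a b c u v w) :
    ((badSet G L a b c u v).filter (G.Adj w)).card ≤ 2 := by
  by_contra hcon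
  obtain ⟨x, y, z, hx, hy, hz, hxy, hxz, hyz⟩ := Finset.two_lt_card_iff.1 (not_le.1 hcon)
  simp only [Finset.mem_filter, mem_badSet] at hx hy hz
  have L3 := fun {x y : V} => S.no_three_left (w₁ := w) (w₂ := x) (w₃ := y) hw
  have R3 := fun {x y : V} => S.no_three_right (w₁ := w) (w₂ := x) (w₃ := y) hw
  rcases S.bad_adj hw hx.2 with e1 | e1 <;> rcases S.bad_adj hw hy.2 with e2 | e2 <;>
    rcases S.bad_adj hw hz.2 with e3 | e3 <;> first
    | exact L3 hx.1 hy.1 hx.2.ne hy.2.ne hxy e1 e2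
    | exact L3 hx.1 hz.1 hx.2.ne hz.2.ne hxz e1 e3
    | exact L3 hy.1 hz.1 hy.2.ne hz.2.ne hyz e2 e3
    | exact R3 hx.1 hy.1 hx.2.ne hy.2.ne hxy e1 e2
    | exact R3 hx.1 hz.1 hx.2.ne hz.2.ne hxz e1 e3
    | exact R3 hy.1 hz.1 hy.2.ne hz.2.ne hyz e2 e3

variable [DecidableEq V]

theorem missing_left_subset : missing G L 0 a u v ⊆ {L (a + 1), L (N - 1)} := by
  intro z hz
  rw [mem_missing] at hz
  rcases S.nextTo_or_alpha hz.1.ne' hz.1 with h | h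
  · exact (hz.2.2 h.within).elim
  · simpa using h

theorem missing_right_subset : missing G L b c u v ⊆ {L (b - 1), L (c + 1)} := by
  intro z hz
  rw [mem_missing] at hz
  rcases S.nextTo_or_beta hz.2.1.ne' hz.2.1 with h | h
  · exact (hz.2.2 h.within).elim
  · simpa using h

theorem outside_left (hz : z ∈ missing G L 0 a u v) : Outside L N a b c z := by
  have h := S.missing_left_subset hz
  rw [mem_missing] at hz
  exact S.outside_alpha hz.1.ne' hz.2.1.ne' (by simpa using h)

theorem outside_right (hz : z ∈ missing G L b c u v) : Outside L N a b c z := by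
  have h := S.missing_right_subset hz
  rw [mem_missing] at hz
  exact S.outside_beta hz.1.ne' hz.2.1.ne' (by simpa using h)

theorem card_missing_left_le : (missing G L 0 a u v).card ≤ 2 :=
  (Finset.card_le_card S.missing_left_subset).trans Finset.card_le_two

theorem card_missing_right_le : (missing G L b c u v).card ≤ 2 :=
  (Finset.card_le_card S.missing_right_subset).trans Finset.card_le_two

/-- If both ends of the first block are missing in it, then every bad vertex has at most one
neighbour that is missing in the second block. -/
theorem eq_of_missing_right {z₁ z₂ : V} (hw : Bad G L a b c u v w)
    (h₁ : z₁ ∈ missing G L b c u v) (h₂ : z₂ ∈ missing G L b c u v) (e₁ : G.Adj w z₁)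
    (e₂ : G.Adj w z₂) (n₁ : z₁ ∉ ({L (a + 1), L (N - 1)} : Finset V))
    (n₂ : z₂ ∉ ({L (a + 1), L (N - 1)} : Finset V)) : z₁ = z₂ := by
  have a₁ := mem_missing.1 h₁
  have a₂ := mem_missing.1 h₂
  refine eq_of_nextTo hw.adju.ne (S.hgapA _ hw.inB) (S.bad_nextTo_left hw)
    (S.hsplitA _ _ hw.inB (S.outside_right h₁)) (S.hsplitA _ _ hw.inB (S.outside_right h₂))
    ((S.nextTo_or_alpha a₁.1.ne' a₁.1).resolve_right (by simpa using n₁))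
    ((S.nextTo_or_alpha a₂.1.ne' a₂.1).resolve_right (by simpa using n₂))
    (S.nextTo_left_of_missing hw h₁ e₁) (S.nextTo_left_of_missing hw h₂ e₂)
    e₁.ne' e₂.ne' a₁.1.ne' a₂.1.ne'

variable [DecidableRel G.Adj]

/-- Four such neighbours would use up both ends outside the first block with vertices missing in it.
The two vertices missing in the second block then stand beside `u` in the first block, and
`eq_of_missing_right` identifies them. -/
theorem card_missing_add_le (hw : Bad G L a b c u v w) :
    ((missing G L 0 a u v).filter (G.Adj w)).card +
      ((missing G L b c u v).filter (G.Adj w)).card ≤ 3 := by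
  by_contra hcon
  have h1 := Finset.card_filter_le (missing G L 0 a u v) (G.Adj w)
  have h2 := Finset.card_filter_le (missing G L b c u v) (G.Adj w)
  have h3 := S.card_missing_left_le
  have h4 := S.card_missing_right_le
  have hP : ((missing G L 0 a u v).filter (G.Adj w)) = {L (a + 1), L (N - 1)} :=
    Finset.eq_of_subset_of_card_le ((Finset.filter_subset _ _).trans S.missing_left_subset)
      (Finset.card_le_two.trans (by omega))
  obtain ⟨z₁, hz₁, z₂, hz₂, hne⟩ := Finset.one_lt_card.1
    (show 1 < ((missing G L b c u v).filter (G.Adj w)).card by omega)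
  rw [Finset.mem_filter] at hz₁ hz₂
  refine hne (S.eq_of_missing_right hw hz₁.1 hz₂.1 hz₁.2 hz₂.2 ?_ ?_)
  · rw [← hP]
    exact fun h => S.notMem_missing_left hw hz₁.1 hz₁.2 (Finset.mem_filter.1 h).1
  · rw [← hP]
    exact fun h => S.notMem_missing_left hw hz₂.1 hz₂.2 (Finset.mem_filter.1 h).1

/-- A neighbour of `w` is `u` or `v`, a non-neighbour of one of them, or a common neighbour. Of the
common neighbours at most two are bad and at most three are missing in a block. -/
theorem degree_bad_add_le (hw : Bad G L a b c u v w) :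
    G.degree w + G.degree u + G.degree v ≤ 2 * Fintype.card V + 5 := by
  have hsub : G.neighborFinset w ⊆ {u, v} ∪ ((badSet G L a b c u v).filter (G.Adj w) ∪
      ((missing G L 0 a u v).filter (G.Adj w) ∪ (missing G L b c u v).filter (G.Adj w))) ∪
      ((insert u (G.neighborFinset u))ᶜ ∪ (insert v (G.neighborFinset v))ᶜ) := by
    intro z hz
    rw [SimpleGraph.mem_neighborFinset] at hz
    have h : z ∈ G.neighborFinset u ∩ G.neighborFinset v →
        z ∈ badSet G L a b c u v ∪ (missing G L 0 a u v ∪ missing G L b c u v) :=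
      fun h => common_subset h
    simp only [Finset.mem_inter, SimpleGraph.mem_neighborFinset, Finset.mem_union] at h
    simp only [Finset.mem_union, Finset.mem_filter, Finset.mem_compl, Finset.mem_insert,
      SimpleGraph.mem_neighborFinset, Finset.mem_singleton]
    tauto
  have h1 := Finset.card_le_card hsub
  have h2 := S.card_bad_adj_le hw
  have h3 := S.card_missing_add_le hw
  have hc : ∀ x : V, ((insert x (G.neighborFinset x))ᶜ).card + G.degree x + 1 =
      Fintype.card V := by
    intro x
    rw [← Finset.card_compl_add_card (insert x (G.neighborFinset x)),
      Finset.card_insert_of_notMem (by simp), SimpleGraph.card_neighborFinset_eq_degree, add_assoc]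
  have hu := hc u
  have hv := hc v
  have h4 := Finset.card_union_le ({u, v} ∪ ((badSet G L a b c u v).filter (G.Adj w) ∪
      ((missing G L 0 a u v).filter (G.Adj w) ∪ (missing G L b c u v).filter (G.Adj w))))
      ((insert u (G.neighborFinset u))ᶜ ∪ (insert v (G.neighborFinset v))ᶜ)
  have h5 := Finset.card_union_le {u, v} ((badSet G L a b c u v).filter (G.Adj w) ∪
      ((missing G L 0 a u v).filter (G.Adj w) ∪ (missing G L b c u v).filter (G.Adj w)))
  have h6 := Finset.card_union_le ((badSet G L a b c u v).filter (G.Adj w))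
      ((missing G L 0 a u v).filter (G.Adj w) ∪ (missing G L b c u v).filter (G.Adj w))
  have h7 := Finset.card_union_le ((missing G L 0 a u v).filter (G.Adj w))
    ((missing G L b c u v).filter (G.Adj w))
  have h8 := Finset.card_union_le (insert u (G.neighborFinset u))ᶜ
    (insert v (G.neighborFinset v))ᶜ
  have h9 : ({u, v} : Finset V).card ≤ 2 := Finset.card_le_two
  rw [SimpleGraph.card_neighborFinset_eq_degree] at h1
  omega

/-- With seven vertices there are at least five common neighbours of `u` and `v`. At most two are
bad and at most three are missing, so there are two bad vertices and some block has two missing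
vertices, both adjacent to both bad ones. This contradicts `no_two_nextTo_two`. -/
theorem card_lt_of_complete (hG : ∀ x y, x ≠ y → G.Adj x y) (hw : Bad G L a b c u v w) :
    Fintype.card V < 7 := by
  by_contra hcard
  have hcommon : Fintype.card V ≤ (G.neighborFinset u ∩ G.neighborFinset v).card + 2 := by
    have hsub : (Finset.univ : Finset V) ⊆ G.neighborFinset u ∩ G.neighborFinset v ∪ {u, v} := by
      intro z _
      simp only [Finset.mem_union, Finset.mem_inter, SimpleGraph.mem_neighborFinset,
        Finset.mem_insert, Finset.mem_singleton]
      by_cases h1 : z = u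
      · exact Or.inr (Or.inl h1)
      by_cases h2 : z = v
      · exact Or.inr (Or.inr h2)
      exact Or.inl ⟨hG _ _ (Ne.symm h1), hG _ _ (Ne.symm h2)⟩
    have h1 := Finset.card_le_card hsub
    have h2 := Finset.card_union_le (G.neighborFinset u ∩ G.neighborFinset v) {u, v}
    have h3 : ({u, v} : Finset V).card ≤ 2 := Finset.card_le_two
    rw [Finset.card_univ] at h1
    omega
  have hP : (missing G L 0 a u v).filter (G.Adj w) = missing G L 0 a u v :=
    Finset.filter_true_of_mem fun z hz => hG _ _ fun e =>
      (mem_missing.1 hz).2.2 (e ▸ hw.inA)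
  have hQ : (missing G L b c u v).filter (G.Adj w) = missing G L b c u v :=
    Finset.filter_true_of_mem fun z hz => hG _ _ fun e =>
      (mem_missing.1 hz).2.2 (e ▸ hw.inB)
  have h3 := S.card_missing_add_le hw
  rw [hP, hQ] at h3
  have hb : (badSet G L a b c u v).card ≤ 2 := by
    by_contra hcon
    obtain ⟨x, y, z, hx, hy, hz, hxy, hxz, hyz⟩ := Finset.two_lt_card_iff.1 (not_le.1 hcon)
    rw [mem_badSet] at hx hy hz
    exact S.no_triangle hx hy hz (hG _ _ hxy) (hG _ _ hxz) (hG _ _ hyz)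
  have hc := Finset.card_le_card
    (common_subset (G := G) (L := L) (a := a) (b := b) (c := c) (u := u) (v := v))
  have hc1 := Finset.card_union_le (badSet G L a b c u v)
    (missing G L 0 a u v ∪ missing G L b c u v)
  have hc2 := Finset.card_union_le (missing G L 0 a u v) (missing G L b c u v)
  obtain ⟨w₁, hw₁, w₂, hw₂, hne⟩ := Finset.one_lt_card.1
    (show 1 < (badSet G L a b c u v).card by omega)
  rw [mem_badSet] at hw₁ hw₂
  have adjP : ∀ {x z}, Bad G L a b c u v x → z ∈ missing G L 0 a u v → G.Adj x z :=
    fun hx hz => hG _ _ fun e => (mem_missing.1 hz).2.2 (e ▸ hx.inA)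
  have adjQ : ∀ {x z}, Bad G L a b c u v x → z ∈ missing G L b c u v → G.Adj x z :=
    fun hx hz => hG _ _ fun e => (mem_missing.1 hz).2.2 (e ▸ hx.inB)
  have h4 := S.card_missing_left_le
  have h5 := S.card_missing_right_le
  have disj : Disjoint (missing G L 0 a u v) (missing G L b c u v) :=
    Finset.disjoint_right.2 fun z hz => S.notMem_missing_left hw hz (adjQ hw hz)
  rcases (show (missing G L b c u v).card = 2 ∨ (missing G L 0 a u v).card = 2 by omega) with
    h6 | h6
  · obtain ⟨z₁, hz₁, z₂, hz₂, hz, hn⟩ : ∃ z₁ ∈ missing G L b c u v, ∃ z₂ ∈ missing G L b c u v,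
        z₁ ≠ z₂ ∧ z₁ ∉ ({L (a + 1), L (N - 1)} : Finset V) := by
      -- The two missing sets are disjoint with three elements in all, too many for the two end
      -- positions.
      have hlt : ¬ missing G L b c u v ⊆ {L (a + 1), L (N - 1)} := by
        intro hsub
        have h7 := Finset.card_le_card (Finset.union_subset S.missing_left_subset hsub)
        rw [Finset.card_union_of_disjoint disj] at h7
        have h8 : ({L (a + 1), L (N - 1)} : Finset V).card ≤ 2 := Finset.card_le_two
        omega
      obtain ⟨z₁, hz₁, hn⟩ := Finset.not_subset.1 hlt
      obtain ⟨z₂, hz₂, hz⟩ := Finset.exists_mem_ne (show 1 < (missing G L b c u v).card by omega) z₁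
      exact ⟨z₁, hz₁, z₂, hz₂, hz.symm, hn⟩
    have m₁ := mem_missing.1 hz₁
    have m₂ := mem_missing.1 hz₂
    exact no_two_nextTo_two hne hw₁.adju.ne hw₂.adju.ne (S.hgapA _ hw₁.inB) (S.hgapA _ hw₂.inB)
      (S.bad_nextTo_left hw₁) (S.bad_nextTo_left hw₂) hz (adjQ hw₁ hz₁).ne' (adjQ hw₁ hz₂).ne'
      (adjQ hw₂ hz₁).ne' (adjQ hw₂ hz₂).ne' m₁.1.ne' m₂.1.ne'
      (S.hsplitA _ _ hw₁.inB (S.outside_right hz₁)) (S.hsplitA _ _ hw₂.inB (S.outside_right hz₁))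
      (S.hsplitA _ _ hw₂.inB (S.outside_right hz₂))
      ((S.nextTo_or_alpha m₁.1.ne' m₁.1).resolve_right (by simpa using hn))
      (S.nextTo_left_of_missing hw₁ hz₁ (adjQ hw₁ hz₁))
      (S.nextTo_left_of_missing hw₁ hz₂ (adjQ hw₁ hz₂))
      (S.nextTo_left_of_missing hw₂ hz₁ (adjQ hw₂ hz₁))
      (S.nextTo_left_of_missing hw₂ hz₂ (adjQ hw₂ hz₂))
  · obtain ⟨z₁, hz₁, z₂, hz₂, hz, hn⟩ : ∃ z₁ ∈ missing G L 0 a u v, ∃ z₂ ∈ missing G L 0 a u v,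
        z₁ ≠ z₂ ∧ z₁ ∉ ({L (b - 1), L (c + 1)} : Finset V) := by
      have hlt : ¬ missing G L 0 a u v ⊆ {L (b - 1), L (c + 1)} := by
        intro hsub
        have h7 := Finset.card_le_card (Finset.union_subset hsub S.missing_right_subset)
        rw [Finset.card_union_of_disjoint disj] at h7
        have h8 : ({L (b - 1), L (c + 1)} : Finset V).card ≤ 2 := Finset.card_le_two
        omega
      obtain ⟨z₁, hz₁, hn⟩ := Finset.not_subset.1 hlt
      obtain ⟨z₂, hz₂, hz⟩ := Finset.exists_mem_ne (show 1 < (missing G L 0 a u v).card by omega) z₁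
      exact ⟨z₁, hz₁, z₂, hz₂, hz.symm, hn⟩
    have m₁ := mem_missing.1 hz₁
    have m₂ := mem_missing.1 hz₂
    exact no_two_nextTo_two hne hw₁.adjv.ne hw₂.adjv.ne (S.hgapB _ hw₁.inA) (S.hgapB _ hw₂.inA)
      (S.bad_nextTo_right hw₁) (S.bad_nextTo_right hw₂) hz (adjP hw₁ hz₁).ne' (adjP hw₁ hz₂).ne'
      (adjP hw₂ hz₁).ne' (adjP hw₂ hz₂).ne' m₁.2.1.ne' m₂.2.1.ne'
      (S.hsplitB _ _ hw₁.inA (S.outside_left hz₁)) (S.hsplitB _ _ hw₂.inA (S.outside_left hz₁))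
      (S.hsplitB _ _ hw₂.inA (S.outside_left hz₂))
      ((S.nextTo_or_beta m₁.2.1.ne' m₁.2.1).resolve_right (by simpa using hn))
      (S.nextTo_right_of_missing hw₁ hz₁ (adjP hw₁ hz₁))
      (S.nextTo_right_of_missing hw₁ hz₂ (adjP hw₁ hz₂))
      (S.nextTo_right_of_missing hw₂ hz₁ (adjP hw₂ hz₁))
      (S.nextTo_right_of_missing hw₂ hz₂ (adjP hw₂ hz₂))

/-- There is no stuck word if the minimum degree is at least `(4n + 2) / 5`. -/
theorem false_of_degree (hδ : ∀ x, 4 * Fintype.card V + 2 ≤ 5 * G.degree x) : False := by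
  have hu := hδ u
  have hv := hδ v
  have hlt := G.degree_lt_card_verts u
  have hcommon := degree_add_le (G := G) (u := u) (v := v)
  have hc := Finset.card_le_card
    (common_subset (G := G) (L := L) (a := a) (b := b) (c := c) (u := u) (v := v))
  have hc1 := Finset.card_union_le (badSet G L a b c u v)
    (missing G L 0 a u v ∪ missing G L b c u v)
  have hc2 := Finset.card_union_le (missing G L 0 a u v) (missing G L b c u v)
  have h4 := S.card_missing_left_le
  have h5 := S.card_missing_right_le
  -- Degrees below `n` force `n ≥ 7`. Then there are at least five common neighbours, and at most
  -- four are missing in a block.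
  obtain ⟨w, hw⟩ := Finset.card_pos.1 (show 0 < (badSet G L a b c u v).card by omega)
  rw [mem_badSet] at hw
  have hd := S.degree_bad_add_le hw
  have hdw := hδ w
  -- The three degree bounds and `hd` give `3(4n + 2) ≤ 5(2n + 5)`, hence `n ≤ 9`. For such `n`, the
  -- minimum degree `(4n + 2) / 5` rounds up to `n - 1`, so the graph is complete.
  have := S.card_lt_of_complete (fun x y hxy => ?_) hw
  · omega
  · have hdx := hδ x
    have : insert x (G.neighborFinset x) = Finset.univ := by
      refine Finset.eq_univ_of_card _ (le_antisymm (Finset.card_le_univ _) ?_)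
      rw [Finset.card_insert_of_notMem (by simp), SimpleGraph.card_neighborFinset_eq_degree]
      omega
    have hy : y ∈ insert x (G.neighborFinset x) := this ▸ Finset.mem_univ y
    simpa [hxy.symm] using hy

end Counting

end Stuck

end PermCycles

/-! ### From an unflippable pair to a stuck word -/

namespace PermCycles

variable {X V : Type*}

theorem hasPattern_of_positions {lab : X → V} {l M : List X} (hM : l ~r M) {L : ℕ → V}
    (hL : ∀ (i : ℕ) (h : i < M.length), L i = lab M[i]) (is : List ℕ) (h1 : is.Pairwise (· < ·))
    (h2 : ∀ i ∈ is, i < M.length) : HasPattern lab l (is.map L) := by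
  refine ⟨M, hM, ?_⟩
  have h3 : (is.pmap (fun i h => (⟨i, h⟩ : Fin M.length)) h2).Pairwise (· < ·) := by
    rw [List.pairwise_pmap]
    exact h1.imp fun h _ _ => h
  have h4 := (List.map_getElem_sublist h3).map lab
  convert h4 using 1
  rw [List.map_map, List.map_pmap]
  refine (List.pmap_eq_map h2).symm.trans ?_
  exact List.pmap_congr_left _ fun i _ h _ => by simp [hL i h]

/-- Start the cyclic list at the first `u` that follows `gv`; the letters after `gv` then contain no
`u`. -/
theorem exists_rotation [DecidableEq V] {lab : X → V} {l : List X} {u v : V} (huv : u ≠ v)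
    {gu gv : X} (hu : gu ∈ l) (hv : gv ∈ l) (hgu : lab gu = u) (hgv : lab gv = v) :
    ∃ M p, l ~r M ∧ ∃ (h0 : 0 < M.length) (hp : p < M.length), lab M[0] = u ∧ lab M[p] = v ∧
      ∀ (i : ℕ) (h : i < M.length), p < i → lab M[i] ≠ u := by
  obtain ⟨s, t, rfl⟩ := List.append_of_mem hv
  have hr : s ++ gv :: t ~r gv :: (t ++ s) := by
    simpa using List.isRotated_append (l := s) (l' := gv :: t)
  have hmem : u ∈ (t ++ s).map lab := by
    have : gu ∈ gv :: (t ++ s) := hr.mem_iff.1 hu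
    rcases List.mem_cons.1 this with rfl | h
    · exact (huv (hgu.symm.trans hgv)).elim
    · exact List.mem_map.2 ⟨gu, h, hgu⟩
  obtain ⟨P, Q, e, hP⟩ := List.eq_append_cons_of_mem hmem
  obtain ⟨B₁, B₂, e1, rfl, e2⟩ := List.map_eq_append_iff.1 e
  obtain ⟨x, B₂, rfl, hx, -⟩ := List.map_eq_cons_iff.1 e2
  rw [e1] at hr
  refine ⟨x :: B₂ ++ gv :: B₁, B₂.length + 1, hr.trans ?_, by simp, by simp, by simpa using hx,
    by simpa using hgv, ?_⟩
  · simpa using List.isRotated_append (l := gv :: B₁) (l' := x :: B₂)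
  · intro i h hi hlab
    refine hP (List.mem_map.2 ⟨_, ?_, hlab⟩)
    obtain ⟨k, rfl⟩ : ∃ k, i = B₂.length + 1 + 1 + k := ⟨i - (B₂.length + 2), by omega⟩
    rw [List.getElem_append_right (by simp; omega)]
    have : B₂.length + 1 + 1 + k - (x :: B₂).length = k + 1 := by simp; omega
    simp only [this, List.getElem_cons_succ]
    exact List.getElem_mem _

variable [Fintype X] [DecidableEq X] [Fintype V] [DecidableEq V]

/-- If the adjacencies of the cyclic sequence of labels form a graph of minimum degree at least
`(4n + 2) / 5`, then the signs at any two vertices can be flipped. -/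
theorem flippable_of_degree {lab : X → V} {l : List X} (hl : l.Nodup) (hmem : ∀ x, x ∈ l)
    (G : SimpleGraph V) [DecidableRel G.Adj]
    (hadj : ∀ x y, G.Adj x y → ∃ g, (lab g = x ∧ lab (l.formPerm g) = y) ∨
      (lab g = y ∧ lab (l.formPerm g) = x))
    (hδ : ∀ x, 4 * Fintype.card V + 2 ≤ 5 * G.degree x) {u v : V} (huv : u ≠ v) :
    Flippable lab l u v := by
  by_contra hflip
  have hocc : ∀ x, ∃ g, lab g = x := by
    intro x
    have h1 := hδ x
    obtain ⟨y, hy⟩ := (G.degree_pos_iff_exists_adj x).1 (by omega)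
    obtain ⟨g, ⟨hg, -⟩ | ⟨-, hg⟩⟩ := hadj x y hy
    · exact ⟨g, hg⟩
    · exact ⟨_, hg⟩
  obtain ⟨gu, hgu⟩ := hocc u
  obtain ⟨gv, hgv⟩ := hocc v
  obtain ⟨M, p, hr, h0, hp, hM0, hMp, hMu⟩ :=
    exists_rotation huv (hmem gu) (hmem gv) hgu hgv
  set N := M.length with hN
  -- Reading positions modulo `N` makes `L N = L 0`, so the closing adjacency appears at `i = N -
  -- 1`.
  let L : ℕ → V := fun i => lab (M[i % N]'(Nat.mod_lt _ h0))
  have hL : ∀ (i : ℕ) (h : i < M.length), L i = lab M[i] := fun i h =>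
    congrArg lab (getElem_congr_idx (Nat.mod_eq_of_lt h))
  have hL0 : L 0 = u := (hL 0 h0).trans hM0
  have hLp : L p = v := (hL p hp).trans hMp
  have hLN : L N = u := by rw [← hL0]; simp [L]
  have pat := fun is h1 h2 => hasPattern_of_positions (lab := lab) hr hL is h1 h2
  have hup : ∀ i < N, L i = u → i < p := by
    intro i hi h
    by_contra hcon
    rcases (not_lt.1 hcon).eq_or_lt with rfl | hlt
    · exact huv (h.symm.trans hLp)
    · exact hMu i hi hlt ((hL i hi).symm.trans h)
  have hfin : ∀ (x : V) (i : ℕ), i < N → L i = x →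
      ∃ a b, a ≤ b ∧ b < N ∧ L a = x ∧ L b = x ∧ ∀ j < N, L j = x → a ≤ j ∧ j ≤ b := by
    intro x i hi h
    let S := (Finset.range N).filter fun i => L i = x
    have hS : S.Nonempty := ⟨i, by simp [S, hi, h]⟩
    have hmin := S.min'_mem hS
    have hmax := S.max'_mem hS
    simp only [S, Finset.mem_filter, Finset.mem_range] at hmin hmax
    refine ⟨S.min' hS, S.max' hS, S.min'_le_max' hS, hmax.1, hmin.2, hmax.2, ?_⟩
    intro j h1 h2
    have hj : j ∈ S := by simp [S, h1, h2]
    exact ⟨S.min'_le j hj, S.le_max' j hj⟩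
  obtain ⟨a₀, a, -, haN, -, ha, hau⟩ := hfin u 0 h0 hL0
  obtain ⟨b, c, hbc, hcN, hb, hc, hbv⟩ := hfin v p hp hLp
  -- Otherwise `0 < b < a < p` carry `u v u v`.
  have hab : a < b := by
    by_contra hcon
    have h1 := hbv p hp hLp
    have h2 := hup a haN ha
    have h3 := pos_ne ha hb huv
    have h4 := pos_ne hL0 hb huv
    refine hflip (flippable_of_interlaced hl ?_)
    have := pat [0, b, a, p] (by simp; omega) (by simp; omega)
    simpa [hL0, hb, ha, hLp] using this
  refine Stuck.false_of_degree (G := G) (L := L) (N := N) (a := a) (b := b) (c := c) (u := u)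
    (v := v) ?_ hδ
  refine ⟨huv, hab, hbc, hcN, hL0, ha, hb, hc, hLN, fun i h1 h2 => (hau i h1 h2).2, hbv,
    ?_, ?_, ?_, ?_, ?_, ?_⟩
  · intro x y hxy
    obtain ⟨g, hg⟩ := hadj x y hxy
    obtain ⟨i, hi, rfl⟩ := List.getElem_of_mem (hr.mem_iff.1 (hmem g))
    have hn := hr.nodup_iff.1 hl
    rw [List.formPerm_eq_of_isRotated hl hr, List.formPerm_apply_getElem _ hn, ← hL i hi] at hg
    exact ⟨i, hi, hg⟩
  · rintro w ⟨i, i1, i2, i3⟩ ⟨j, j1, j2, j3⟩ ⟨k, hk | hk, k3⟩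
    · refine hflip (flippable_of_pattern_one (w := w) hl ?_)
      have := pat [0, i, a, k, b, j, c] (by simp; omega) (by simp; omega)
      simpa [hL0, hb, ha, hc, i3, j3, k3] using this
    · refine hflip (flippable_of_pattern_two (w := w) hl ?_)
      have := pat [0, i, a, b, j, c, k] (by simp; omega) (by simp; omega)
      simpa [hL0, hb, ha, hc, i3, j3, k3] using this
  · rintro w ⟨k, k1, k2, k3⟩ i m j i1 i2 i4 i5 i3 m3 j3
    refine hflip (flippable_of_pattern_three (w := w) hl ?_)
    have := pat [0, i, m, j, a, b, k, c] (by simp; omega) (by simp; omega)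
    simpa [hL0, hb, ha, hc, i3, j3, k3, m3] using this
  · rintro w ⟨k, k1, k2, k3⟩ i m j i1 i2 i4 i5 i3 m3 j3
    refine hflip (flippable_of_pattern_four (w := w) hl ?_)
    have := pat [0, k, a, b, i, m, j, c] (by simp; omega) (by simp; omega)
    simpa [hL0, hb, ha, hc, i3, j3, k3, m3] using this
  · rintro w z ⟨k, k1, k2, k3⟩ ⟨o, o1, o3⟩ x y x' y' x1 x2 y2 x4 x3 y3 x3' y1' y2' hy y3'
    rcases hy with hy | hy <;> rcases o1 with o1 | o1
    · refine hflip (flippable_of_pattern_seven (w := w) (q := z) hl ?_)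
      have := pat [0, y', x, y, x', a, o, b, k, c] (by simp; omega) (by simp; omega)
      simpa [hL0, hb, ha, hc, k3, o3, x3, y3, x3', y3'] using this
    · refine hflip (flippable_of_pattern_eight (w := w) (q := z) hl ?_)
      have := pat [0, y', x, y, x', a, b, k, c, o] (by simp; omega) (by simp; omega)
      simpa [hL0, hb, ha, hc, k3, o3, x3, y3, x3', y3'] using this
    · refine hflip (flippable_of_pattern_five (w := w) (q := z) hl ?_)
      have := pat [0, x, y, x', y', a, o, b, k, c] (by simp; omega) (by simp; omega)
      simpa [hL0, hb, ha, hc, k3, o3, x3, y3, x3', y3'] using this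
    · refine hflip (flippable_of_pattern_six (w := w) (q := z) hl ?_)
      have := pat [0, x, y, x', y', a, b, k, c, o] (by simp; omega) (by simp; omega)
      simpa [hL0, hb, ha, hc, k3, o3, x3, y3, x3', y3'] using this
  · rintro w z ⟨k, k1, k2, k3⟩ ⟨o, o1, o3⟩ x y x' y' x1 x2 y2 x4 x3 y3 x3' y1' y2' hy y3'
    rcases hy with hy | hy <;> rcases o1 with o1 | o1
    · refine hflip (flippable_of_pattern_eight (w := w) (q := z) hl ?_).symm
      refine HasPattern.rotate [u, w, u, z] [v, z, w, z, w, v] ?_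
      have := pat [0, k, a, o, b, y', x, y, x', c] (by simp; omega) (by simp; omega)
      simpa [hL0, hb, ha, hc, k3, o3, x3, y3, x3', y3'] using this
    · refine hflip (flippable_of_pattern_seven (w := w) (q := z) hl ?_).symm
      refine HasPattern.rotate [u, w, u] [v, z, w, z, w, v, z] ?_
      have := pat [0, k, a, b, y', x, y, x', c, o] (by simp; omega) (by simp; omega)
      simpa [hL0, hb, ha, hc, k3, o3, x3, y3, x3', y3'] using this
    · refine hflip (flippable_of_pattern_six (w := w) (q := z) hl ?_).symm
      refine HasPattern.rotate [u, w, u, z] [v, w, z, w, z, v] ?_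
      have := pat [0, k, a, o, b, x, y, x', y', c] (by simp; omega) (by simp; omega)
      simpa [hL0, hb, ha, hc, k3, o3, x3, y3, x3', y3'] using this
    · refine hflip (flippable_of_pattern_five (w := w) (q := z) hl ?_).symm
      refine HasPattern.rotate [u, w, u] [v, w, z, w, z, v, z] ?_
      have := pat [0, k, a, b, x, y, x', y', c, o] (by simp; omega) (by simp; omega)
      simpa [hL0, hb, ha, hc, k3, o3, x3, y3, x3', y3'] using this

end PermCycles

/-! ### Correcting signs and fusing cycles -/

namespace PermCycles

variable {X V : Type*}

theorem sameCycle_formPerm [DecidableEq X] {l : List X} (hl : l.Nodup) {x y : X} (hx : x ∈ l)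
    (hy : y ∈ l) : SameCycle l.formPerm x y := by
  obtain ⟨i, hi, rfl⟩ := List.getElem_of_mem hx
  obtain ⟨j, hj, rfl⟩ := List.getElem_of_mem hy
  refine ⟨((j + (l.length - i) : ℕ) : ℤ), ?_⟩
  rw [zpow_natCast, List.formPerm_pow_apply_getElem _ hl]
  refine getElem_congr_idx ?_
  rw [show i + (j + (l.length - i)) = j + l.length by omega, Nat.add_mod_right,
    Nat.mod_eq_of_lt hj]

theorem exists_rotation_three {l : List X} {x y z : X} (hx : x ∈ l) (hy : y ∈ l) (hz : z ∈ l)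
    (hxy : x ≠ y) (hxz : x ≠ z) (hyz : y ≠ z) :
    ∃ P Q R, l ~r x :: P ++ y :: Q ++ z :: R ∨ l ~r x :: P ++ z :: Q ++ y :: R := by
  obtain ⟨s, t, rfl⟩ := List.append_of_mem hx
  have hr : s ++ x :: t ~r x :: (t ++ s) := by
    simpa using List.isRotated_append (l := s) (l' := x :: t)
  have hy' := (List.mem_cons.1 (hr.mem_iff.1 hy)).resolve_left hxy.symm
  have hz' := (List.mem_cons.1 (hr.mem_iff.1 hz)).resolve_left hxz.symm
  obtain ⟨P, Q, e⟩ := List.append_of_mem hy'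
  rw [e] at hr hz'
  rcases List.mem_append.1 hz' with h | h
  · obtain ⟨A, B, rfl⟩ := List.append_of_mem h
    exact ⟨A, B, Q, Or.inr (by simpa using hr)⟩
  · obtain ⟨A, B, rfl⟩ := List.append_of_mem ((List.mem_cons.1 h).resolve_left hyz.symm)
    exact ⟨P, A, B, Or.inl (by simpa using hr)⟩

theorem exists_three_of_numCycles [Finite X] {f : Perm X} (h : 2 < numCycles f) :
    ∃ x y z, ¬ SameCycle f x y ∧ ¬ SameCycle f x z ∧ ¬ SameCycle f y z := by
  classical
  have := Fintype.ofFinite (Quotient (SameCycle.setoid f))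
  rw [numCycles, Nat.card_eq_fintype_card] at h
  obtain ⟨⟨x⟩, ⟨y⟩, ⟨z⟩, hxy, hxz, hyz⟩ := Fintype.two_lt_card_iff.1 h
  exact ⟨x, y, z, fun h => hxy (Quotient.sound h), fun h => hxz (Quotient.sound h),
    fun h => hyz (Quotient.sound h)⟩

theorem numCycles_swap_mul_swap_mul [Finite X] [DecidableEq X] {f : Perm X} {x y z : X}
    (hxy : ¬ SameCycle f x y) (hxz : ¬ SameCycle f x z) (hyz : ¬ SameCycle f y z) :
    numCycles (swap x z * (swap x y * f)) + 2 = numCycles f := by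
  rw [← numCycles_swap_mul hxy, ← numCycles_swap_mul (f := swap x y * f) (x := x) (y := z)]
  intro h
  rcases sameCycle_or_of_swap_mul h with h | ⟨-, h | h⟩
  · exact hxz h
  · exact hxz h
  · exact hyz h

/-- If `x` and `y` stayed in one cycle, the product would still be a single cycle, with the wrong
sign. So they are separated, and the transposition merges the pieces back into one. -/
theorem numCycles_swap_mul_of_transitive [Finite X] [DecidableEq X] {f : Perm X} {x y : X}
    (hxy : x ≠ y) (h : ∀ a b, SameCycle f a b) : numCycles (swap x y * f) = 2 := by
  have := Fintype.ofFinite X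
  have : Nonempty X := ⟨x⟩
  have e : swap x y * (swap x y * f) = f := swap_mul_self_mul x y f
  have h1 := numCycles_eq_one h
  by_cases hs : SameCycle (swap x y * f) x y
  · exfalso
    have hall : ∀ a b, SameCycle (swap x y * f) a b := by
      intro a b
      have hab := h a b
      rw [← e] at hab
      rcases sameCycle_or_of_swap_mul hab with h | ⟨h1, h2⟩
      · exact h
      · have h1' : SameCycle (swap x y * f) x a := h1.elim id hs.trans
        have h2' : SameCycle (swap x y * f) x b := h2.elim id hs.trans
        exact h1'.symm.trans h2'
    have h2 := sign_of_forall_sameCycle hall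
    rw [Perm.sign_mul, sign_swap hxy, sign_of_forall_sameCycle h] at h2
    have h3 : (-1 : ℤˣ) = 1 := mul_right_cancel (h2.trans (one_mul _).symm)
    exact absurd h3 (by decide)
  · have h2 := numCycles_swap_mul hs
    rw [e, h1] at h2
    exact h2.symm

variable [Fintype X] [DecidableEq X] [Fintype V] [DecidableEq V] {lab : X → V}

/-- Cycles of a permutation of a fibre can be fused three at a time. -/
theorem exists_fuse {l₀ l : List X} (hl : l.Nodup) (hmem : ∀ x, x ∈ l)
    {s : ∀ v, Perm {x // lab x = v}} (hs : l.formPerm = fiberPerm lab s * l₀.formPerm) :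
    ∃ (l' : List X) (s' : ∀ v, Perm {x // lab x = v}), l.Perm l' ∧
      l'.formPerm = fiberPerm lab s' * l₀.formPerm ∧
      (∀ v, sign (s' v) = sign (s v)) ∧ ∀ v, numCycles (s' v) ≤ 2 := by
  generalize hn : ∑ v, numCycles (s v) = n
  induction n using Nat.strong_induction_on generalizing l s with
  | _ n ih =>
    by_cases hle : ∀ v, numCycles (s v) ≤ 2
    · exact ⟨l, s, List.Perm.refl _, hs, fun _ => rfl, hle⟩
    · push Not at hle
      obtain ⟨v, hv⟩ := hle
      have main : ∀ x y z : {x // lab x = v}, ¬ SameCycle (s v) x y → ¬ SameCycle (s v) x z →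
          ¬ SameCycle (s v) y z → ∀ P Q R, l ~r (x : X) :: P ++ (y : X) :: Q ++ (z : X) :: R →
          ∃ (l' : List X) (s' : ∀ v, Perm {x // lab x = v}), l.Perm l' ∧
            l'.formPerm = fiberPerm lab s' * l₀.formPerm ∧
            (∀ v, sign (s' v) = sign (s v)) ∧ ∀ v, numCycles (s' v) ≤ 2 := by
        intro x y z hxy hxz hyz P Q R hr
        have hnd := hr.nodup_iff.1 hl
        set s₁ : ∀ v, Perm {x // lab x = v} :=
          Pi.mulSingle v (swap x z) * (Pi.mulSingle v (swap x y) * s) with hs₁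
        have hs₁v : s₁ v = swap x z * (swap x y * s v) := by simp [hs₁]
        have hs₁w : ∀ w, w ≠ v → s₁ w = s w := by
          intro w hw
          simp [hs₁, Pi.mulSingle_eq_of_ne hw]
        have hf : ((x : X) :: P ++ (z : X) :: R ++ (y : X) :: Q).formPerm =
            fiberPerm lab s₁ * l₀.formPerm := by
          rw [formPerm_exchange_three hnd, ← List.formPerm_eq_of_isRotated hl hr, hs, hs₁, map_mul,
            map_mul, fiberPerm_mulSingle_swap, fiberPerm_mulSingle_swap]
          simp only [mul_assoc]
        have hp : l.Perm ((x : X) :: P ++ (z : X) :: R ++ (y : X) :: Q) := by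
          refine hr.perm.trans ?_
          rw [List.append_assoc, List.append_assoc]
          exact List.Perm.append_left _ List.perm_append_comm
        have hnum : numCycles (s₁ v) + 2 = numCycles (s v) := by
          rw [hs₁v]
          exact numCycles_swap_mul_swap_mul hxy hxz hyz
        have hsum : ∑ w, numCycles (s₁ w) < n := by
          rw [← hn]
          refine Finset.sum_lt_sum (fun w _ => ?_) ⟨v, Finset.mem_univ _, by omega⟩
          rcases eq_or_ne w v with rfl | hw
          · omega
          · rw [hs₁w w hw]
        obtain ⟨l', s', h1, h2, h3, h4⟩ := ih _ hsum (hp.nodup_iff.1 hl)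
          (fun t => hp.mem_iff.1 (hmem t)) hf rfl
        refine ⟨l', s', hp.trans h1, h2, fun w => (h3 w).trans ?_, h4⟩
        rcases eq_or_ne w v with rfl | hw
        · have hxy' : x ≠ y := fun e => hxy (e ▸ SameCycle.refl _ _)
          have hxz' : x ≠ z := fun e => hxz (e ▸ SameCycle.refl _ _)
          rw [hs₁v, Perm.sign_mul, Perm.sign_mul, sign_swap hxy', sign_swap hxz']
          simp
        · rw [hs₁w w hw]
      obtain ⟨x, y, z, hxy, hxz, hyz⟩ := exists_three_of_numCycles hv
      have ne : ∀ {a b : {x // lab x = v}}, ¬ SameCycle (s v) a b → (a : X) ≠ b :=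
        fun h e => h (Subtype.ext e ▸ SameCycle.refl _ _)
      -- Either cyclic order will do: both 3-cycles fuse the three cycles.
      obtain ⟨P, Q, R, hr | hr⟩ := exists_rotation_three (hmem x) (hmem y) (hmem z) (ne hxy)
        (ne hxz) (ne hyz)
      · exact main x y z hxy hxz hyz P Q R hr
      · exact main x z y hxz hxy (fun h => hyz h.symm) P Q R hr

/-- While two signs are wrong, flipping them both corrects both and changes no other. -/
theorem exists_reach_sign {l₀ : List X} (ε : V → ℤˣ)
    (hflip : ∀ l δ, Reach lab l₀ l δ → ∀ u v, u ≠ v → Flippable lab l u v) :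
    ∃ l δ, Reach lab l₀ l δ ∧ (Finset.univ.filter fun v => δ v ≠ ε v).card ≤ 1 := by
  have key : ∀ n l δ, Reach lab l₀ l δ → (Finset.univ.filter fun v => δ v ≠ ε v).card = n →
      ∃ l δ, Reach lab l₀ l δ ∧ (Finset.univ.filter fun v => δ v ≠ ε v).card ≤ 1 := by
    intro n
    induction n using Nat.strong_induction_on with
    | _ n ih =>
      intro l δ hr hn
      by_cases h1 : n ≤ 1
      · exact ⟨l, δ, hr, hn.trans_le h1⟩
      · obtain ⟨u, hu, v, hv, huv⟩ := Finset.one_lt_card.1 (hn.symm ▸ not_le.1 h1)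
        obtain ⟨l', hl'⟩ := hflip l δ hr u v huv
        refine ih _ ?_ l' _ (hr.trans hl') rfl
        rw [← hn]
        refine Finset.card_lt_card ((Finset.ssubset_iff_of_subset ?_).2 ⟨u, hu, ?_⟩)
        · intro w hw
          simp only [Finset.mem_filter, Finset.mem_univ, true_and] at hw hu hv ⊢
          by_cases hwu : w = u
          · exact hwu ▸ hu
          by_cases hwv : w = v
          · exact hwv ▸ hv
          simpa [pairSign, Pi.mulSingle_eq_of_ne hwu, Pi.mulSingle_eq_of_ne hwv] using hw
        · simp only [Finset.mem_filter, Finset.mem_univ, true_and, not_not] at hu ⊢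
          simp only [pairSign, Pi.mul_apply, Pi.mulSingle_eq_same, Pi.mulSingle_eq_of_ne huv]
          rcases Int.units_eq_one_or (δ u) with h | h <;>
            rcases Int.units_eq_one_or (ε u) with h' | h' <;> simp_all
  exact key _ l₀ 1 ⟨List.Perm.refl _, 1, by simp, by simp⟩ rfl

/-- A cyclic sequence in which the adjacencies of labels form a graph of minimum degree at least
`(4n + 2) / 5` can be multiplied by a permutation whose cycles are the fibres of `lab` such that
the product has one or two cycles. -/
theorem exists_fiberPerm_numCycles {l₀ : List X} (hl : l₀.Nodup) (hmem : ∀ x, x ∈ l₀)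
    [Nonempty X] (hsurj : Function.Surjective lab) (G : SimpleGraph V) [DecidableRel G.Adj]
    (hadj : ∀ x y, G.Adj x y → ∃ g, (lab g = x ∧ lab (l₀.formPerm g) = y) ∨
      (lab g = y ∧ lab (l₀.formPerm g) = x))
    (hδ : ∀ x, 4 * Fintype.card V + 2 ≤ 5 * G.degree x) :
    ∃ s : ∀ v, Perm {x // lab x = v}, (∀ v x y, SameCycle (s v) x y) ∧
      (numCycles (fiberPerm lab s * l₀.formPerm) = 1 ∨
        numCycles (fiberPerm lab s * l₀.formPerm) = 2) := by
  obtain ⟨l, δ, ⟨hp, s, hs, hsδ⟩, hcard⟩ := exists_reach_sign (lab := lab) (l₀ := l₀)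
    -- The target is the sign of a permutation that is one cycle on the whole fibre.
    (fun v => (-1) ^ (Fintype.card {x // lab x = v} + 1)) (by
      rintro l δ ⟨hp, s, hs, -⟩ u v huv
      refine flippable_of_degree (hp.nodup_iff.1 hl) (fun x => hp.mem_iff.1 (hmem x)) G ?_ hδ huv
      intro x y hxy
      obtain ⟨g, hg⟩ := hadj x y hxy
      refine ⟨g, ?_⟩
      -- A reached list gives each element a successor with the same label as before, so the
      -- adjacencies survive every move.
      rwa [hs, Perm.mul_apply, lab_fiberPerm lab])
  obtain ⟨l', s', hp', hs', hsign, hle⟩ := exists_fuse (hp.nodup_iff.1 hl)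
    (fun x => hp.mem_iff.1 (hmem x)) hs
  have hl' := (hp.trans hp').nodup_iff.1 hl
  have hmem' := fun x => (hp.trans hp').mem_iff.1 (hmem x)
  have htrans : ∀ a b, SameCycle l'.formPerm a b :=
    fun a b => sameCycle_formPerm hl' (hmem' a) (hmem' b)
  have hgood : ∀ v, δ v = (-1) ^ (Fintype.card {x // lab x = v} + 1) → numCycles (s' v) = 1 := by
    intro v hv
    have h1 := hsign v
    rw [hsδ, hv, sign_eq_numCycles] at h1
    have h2 := even_add_of_neg_one_pow_eq h1
    have h3 := hle v
    rw [Nat.even_iff] at h2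
    omega
  by_cases hall : ∀ v, δ v = (-1) ^ (Fintype.card {x // lab x = v} + 1)
  · refine ⟨s', fun v => sameCycle_of_numCycles_le_one (hgood v (hall v)).le, Or.inl ?_⟩
    rw [← hs']
    exact numCycles_eq_one htrans
  · push Not at hall
    obtain ⟨t, ht⟩ := hall
    have hne : ∀ v, v ≠ t → numCycles (s' v) = 1 := by
      intro v hv
      refine hgood v ?_
      by_contra hcon
      exact hv (Finset.card_le_one.1 hcard v (by simpa using hcon) t (by simpa using ht))
    by_cases hst : ∀ x y, SameCycle (s' t) x y
    · exfalso
      obtain ⟨x, hx⟩ := hsurj t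
      have : Nonempty {x // lab x = t} := ⟨⟨x, hx⟩⟩
      refine ht ?_
      rw [← hsδ, ← hsign, sign_of_forall_sameCycle hst]
    · push Not at hst
      obtain ⟨x, y, hxy⟩ := hst
      have hxy' : (x : X) ≠ y := fun e => hxy (Subtype.ext e ▸ SameCycle.refl _ _)
      -- One transposition joins the two cycles at `t`, at the price of splitting the product.
      refine ⟨Pi.mulSingle t (swap x y) * s', fun v => ?_, Or.inr ?_⟩
      · rcases eq_or_ne v t with rfl | hv
        · refine sameCycle_of_numCycles_le_one ?_
          have h1 := numCycles_swap_mul hxy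
          have h2 := hle v
          simp only [Pi.mul_apply, Pi.mulSingle_eq_same]
          omega
        · refine sameCycle_of_numCycles_le_one ?_
          simp only [Pi.mul_apply, Pi.mulSingle_eq_of_ne hv, one_mul]
          exact (hne v hv).le
      · rw [map_mul, fiberPerm_mulSingle_swap, mul_assoc, ← hs']
        exact numCycles_swap_mul_of_transitive hxy' htrans

end PermCycles

/-! ### Cyclic sequences and orbits -/

namespace PermCycles

variable {α : Type*}

theorem chain_reverse_iff {r : α → α → Prop} {s : Cycle α} :
    s.reverse.Chain r ↔ s.Chain fun a b => r b a := by
  induction s using Quotient.inductionOn with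
  | _ l =>
    cases l with
    | nil => exact Iff.rfl
    | cons a l =>
      have e : ((a :: l : List α) : Cycle α).reverse = ((a :: l.reverse : List α) : Cycle α) := by
        rw [Cycle.reverse_coe, List.reverse_cons]
        exact Cycle.coe_eq_coe.2 (List.isRotated_concat a l.reverse)
      change ((a :: l : List α) : Cycle α).reverse.Chain r ↔ ((a :: l : List α) : Cycle α).Chain _
      rw [e, Cycle.chain_coe_cons, Cycle.chain_coe_cons, ← List.isChain_reverse]
      simp

theorem chain_iff_formPerm [DecidableEq α] {r : α → α → Prop} {l : List α} (hl : l.Nodup) :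
    (l : Cycle α).Chain r ↔ ∀ x ∈ l, r x (l.formPerm x) := by
  cases l with
  | nil => simp
  | cons a t =>
    rw [Cycle.chain_coe_cons, List.isChain_iff_getElem]
    have key : ∀ (i : ℕ) (hi : i < (a :: t).length),
        (a :: (t ++ [a]))[i]'(by simp at hi ⊢; omega) = (a :: t)[i] ∧
        (a :: (t ++ [a]))[i + 1]'(by simp at hi ⊢; omega) = (a :: t).formPerm (a :: t)[i] := by
      intro i hi
      rw [List.formPerm_apply_getElem _ hl]
      constructor
      · simp only [← List.cons_append]
        rw [List.getElem_append_left]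
      · simp only [List.length_cons] at hi
        rcases eq_or_ne i t.length with rfl | hne
        · simp
        · have : (i + 1) % (a :: t).length = i + 1 := Nat.mod_eq_of_lt (by simp; omega)
          simp only [this, List.getElem_cons_succ]
          rw [List.getElem_append_left]
    constructor
    · intro h x hx
      obtain ⟨i, hi, rfl⟩ := List.getElem_of_mem hx
      have := h i (by simp at hi ⊢; omega)
      rwa [(key i hi).1, (key i hi).2] at this
    · intro h i hi
      have hi' : i < (a :: t).length := by simp at hi ⊢; omega
      rw [(key i hi').1, (key i hi').2]
      exact h _ (List.getElem_mem _)

theorem mem_periodicOrbit_iff_sameCycle [Finite α] {f : Perm α} {x y : α} :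
    y ∈ Function.periodicOrbit f x ↔ SameCycle f x y := by
  rw [Function.mem_periodicOrbit_iff (f.injective.mem_periodicPts x)]
  constructor
  · rintro ⟨n, rfl⟩
    exact ⟨n, by rw [zpow_natCast, Perm.iterate_eq_pow]⟩
  · intro h
    obtain ⟨n, hn⟩ := h.exists_nat_pow_eq
    exact ⟨n, by rw [← hn, ← Perm.iterate_eq_pow]⟩

theorem chain_periodicOrbit [Finite α] {f : Perm α} {x : α} {r : α → α → Prop}
    (h : ∀ a, r a (f a)) : (Function.periodicOrbit f x).Chain r := by
  rw [Function.periodicOrbit_chain' _ (f.injective.mem_periodicPts x)]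
  intro n
  rw [Function.iterate_succ_apply']
  exact h _

theorem nodup_map_of_injective {β : Type*} {s : Cycle α} (hs : s.Nodup) {f : α → β}
    (hf : Function.Injective f) : (s.map f).Nodup := by
  induction s using Quotient.inductionOn with
  | _ l => exact List.Nodup.map hf hs

theorem numCycles_eq_card {β : Type*} {f : Perm α} {p : α → β}
    (h : ∀ a b, SameCycle f a b ↔ p a = p b) (hp : Function.Surjective p) :
    numCycles f = Nat.card β := by
  refine Nat.card_eq_of_bijective
    (Quotient.lift (s := SameCycle.setoid f) p fun a b hab => (h a b).1 hab) ⟨?_, ?_⟩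
  · rintro ⟨a⟩ ⟨b⟩ hab
    exact Quotient.sound ((h a b).2 hab)
  · intro b
    obtain ⟨a, rfl⟩ := hp b
    exact ⟨Quotient.mk _ a, rfl⟩

end PermCycles

/-! ### Faces of oriented embeddings -/

namespace HalfArcDigraph

open PermCycles

variable {V Out In : Type*} {D : HalfArcDigraph V Out In}

namespace OrientedEmbedding

section General

variable (Φ : D.OrientedEmbedding)

theorem card_face : Nat.card Φ.Face = numCycles Φ.facePerm := rfl

theorem faceOf_eq_iff {h h' : Out ⊕ In} : Φ.faceOf h = Φ.faceOf h' ↔ Φ.facePerm.SameCycle h h' :=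
  Quotient.eq (r := SameCycle.setoid Φ.facePerm)

/-- The parity of the number of faces does not depend on the embedding. -/
theorem even_card_face [Finite Out] [Finite In] (hD : Function.Surjective D.inc) :
    Even (Nat.card Φ.Face + (numCycles D.matePerm + Nat.card V + Nat.card (Out ⊕ In))) := by
  have h := even_numCycles_mul Φ.rot⁻¹ D.matePerm
  rw [numCycles_inv, numCycles_eq_card Φ.sameCycle_iff hD] at h
  have e : Φ.rot⁻¹ * D.matePerm = Φ.facePerm := rfl
  rw [e] at h
  rw [card_face]
  convert h using 1
  omega

/-- The two sides of an arc lie in different faces, since a directed facial walk leaves its vertices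
only on outgoing or only on incoming half-arcs. -/
theorem two_le_card_face [Finite Out] [Finite In] [Nonempty Out] (h : Φ.IsDirected) :
    2 ≤ Nat.card Φ.Face := by
  have : Finite Φ.Face := Quotient.finite _
  have := Fintype.ofFinite Φ.Face
  obtain ⟨g⟩ := ‹Nonempty Out›
  rw [Nat.card_eq_fintype_card]
  refine Fintype.one_lt_card_iff.2 ⟨Φ.faceOf (Sum.inl g), Φ.faceOf (Sum.inr (D.mate g)), ?_⟩
  intro heq
  obtain ⟨C, hC | hC⟩ := h (Φ.faceOf (Sum.inl g))
  · have h1 := (hC.2.2.2 (Sum.inr (D.mate g))).2 heq.symm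
    rw [Cycle.mem_map] at h1
    obtain ⟨_, -, h1⟩ := h1
    cases h1
  · have h1 := (hC.2.2.2 (Sum.inl g)).2 rfl
    rw [Cycle.mem_reverse_iff, Cycle.mem_map] at h1
    obtain ⟨_, -, h1⟩ := h1
    cases h1

end General

/-! ### Embeddings built from a pair of permutations of the arcs -/

section OfPerms

variable {τ σ : Perm Out}

/-- The rotation in which an outgoing half-arc `g` is followed by the mate of `τ⁻¹ g`, and the next
outgoing half-arc is `σ g`. -/
def rotOfPerms (D : HalfArcDigraph V Out In) (τ σ : Perm Out) : Perm (Out ⊕ In) where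
  toFun := Sum.elim (fun g => Sum.inr (D.mate (τ.symm g)))
    (fun h => Sum.inl (σ (τ (D.mate.symm h))))
  invFun := Sum.elim (fun g => Sum.inr (D.mate (τ.symm (σ.symm g))))
    (fun h => Sum.inl (τ (D.mate.symm h)))
  left_inv := by rintro (g | h) <;> simp
  right_inv := by rintro (g | h) <;> simp

theorem rotOfPerms_inl (g : Out) :
    rotOfPerms D τ σ (Sum.inl g) = Sum.inr (D.mate (τ.symm g)) := rfl

theorem rotOfPerms_inr (h : In) :
    rotOfPerms D τ σ (Sum.inr h) = Sum.inl (σ (τ (D.mate.symm h))) := rfl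

theorem rotOfPerms_pow_inl (n : ℕ) (g : Out) :
    (rotOfPerms D τ σ ^ (2 * n)) (Sum.inl g) = Sum.inl ((σ ^ n) g) := by
  induction n generalizing g with
  | zero => simp
  | succ n ih =>
    rw [Nat.mul_succ, pow_add, Perm.mul_apply, sq, Perm.mul_apply, rotOfPerms_inl, rotOfPerms_inr,
      symm_apply_apply, apply_symm_apply, ih, pow_succ, Perm.mul_apply]

theorem sameCycle_rotOfPerms_inl {g g' : Out} (h : σ.SameCycle g g') :
    (rotOfPerms D τ σ).SameCycle (Sum.inl g) (Sum.inl g') := by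
  have key : ∀ (n : ℕ) g, (rotOfPerms D τ σ).SameCycle (Sum.inl g) (Sum.inl ((σ ^ n) g)) :=
    fun n g => ⟨((2 * n : ℕ) : ℤ), by rw [zpow_natCast, rotOfPerms_pow_inl]⟩
  obtain ⟨n, rfl⟩ := h
  obtain ⟨k, rfl | rfl⟩ := n.eq_nat_or_neg
  · rw [zpow_natCast]
    exact key k g
  · have := key k ((σ ^ (-(k : ℤ))) g)
    rw [← zpow_natCast, ← Perm.mul_apply, ← zpow_add] at this
    simpa using this.symm

theorem inc_rotOfPerms (hτ : ∀ g, D.head g = D.tail (τ g)) (hσ : ∀ g, D.tail (σ g) = D.tail g)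
    (h : Out ⊕ In) : D.inc (rotOfPerms D τ σ h) = D.inc h := by
  rcases h with g | h
  · rw [rotOfPerms_inl]
    have := hτ (τ.symm g)
    rw [apply_symm_apply] at this
    exact this
  · rw [rotOfPerms_inr]
    change D.tail _ = _
    rw [hσ, ← hτ, head, apply_symm_apply]

/-- The oriented embedding in which the clockwise facial walks follow the permutation `τ` of the
arcs, and consecutive outgoing half-arcs at a vertex are given by `σ`. -/
def ofPerms (D : HalfArcDigraph V Out In) (τ σ : Perm Out) (hτ : ∀ g, D.head g = D.tail (τ g))
    (hσ : ∀ g g', σ.SameCycle g g' ↔ D.tail g = D.tail g') : D.OrientedEmbedding where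
  rot := rotOfPerms D τ σ
  sameCycle_iff := by
    have hinc := inc_rotOfPerms hτ fun g => ((hσ g (σ g)).1 ⟨1, by simp⟩).symm
    have hmem : ∀ h, ∃ g, (rotOfPerms D τ σ).SameCycle h (Sum.inl g) := by
      rintro (g | h)
      · exact ⟨g, SameCycle.refl _ _⟩
      · exact ⟨_, 1, by rw [zpow_one, rotOfPerms_inr]⟩
    have hfwd : ∀ h h', (rotOfPerms D τ σ).SameCycle h h' → D.inc h = D.inc h' := by
      rintro h _ ⟨n, rfl⟩
      induction n using Int.induction_on with
      | zero => rfl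
      | succ n ih => rw [add_comm, zpow_add, Perm.mul_apply, zpow_one, hinc, ih]
      | pred n ih =>
        rw [← hinc ((rotOfPerms D τ σ ^ (-(n : ℤ) - 1)) h), ← Perm.mul_apply, ← zpow_one_add]
        simpa using ih
    refine fun h h' => ⟨hfwd h h', fun hh => ?_⟩
    obtain ⟨g, hg⟩ := hmem h
    obtain ⟨g', hg'⟩ := hmem h'
    have htail : D.tail g = D.tail g' := (hfwd _ _ hg).symm.trans (hh.trans (hfwd _ _ hg'))
    exact hg.trans ((sameCycle_rotOfPerms_inl ((hσ g g').2 htail)).trans hg'.symm)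

variable (hτ : ∀ g, D.head g = D.tail (τ g))
  (hσ : ∀ g g', σ.SameCycle g g' ↔ D.tail g = D.tail g')

/-- Face tracing never mixes outgoing and incoming half-arcs, so every face is a cycle of `τ` or,
backwards, a cycle of `σ * τ`. -/
theorem facePerm_ofPerms : (ofPerms D τ σ hτ hσ).facePerm =
    sumCongrHom Out In (τ, D.mate.permCongrHom (σ * τ)⁻¹) := by
  ext (g | h)
  · simp [facePerm, ofPerms, rotOfPerms, matePerm]
  · simp [facePerm, ofPerms, rotOfPerms, matePerm]

theorem facePerm_zpow_inl (n : ℤ) (g : Out) :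
    ((ofPerms D τ σ hτ hσ).facePerm ^ n) (Sum.inl g) = Sum.inl ((τ ^ n) g) := by
  rw [facePerm_ofPerms, ← map_zpow]
  rfl

theorem facePerm_zpow_inr (n : ℤ) (g : Out) :
    ((ofPerms D τ σ hτ hσ).facePerm ^ n) (Sum.inr (D.mate g)) =
      Sum.inr (D.mate (((σ * τ)⁻¹ ^ n) g)) := by
  rw [facePerm_ofPerms, ← map_zpow, Prod.pow_mk, ← map_zpow]
  simp

theorem faceOf_inl_eq_iff {g g' : Out} : (ofPerms D τ σ hτ hσ).faceOf (Sum.inl g) =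
    (ofPerms D τ σ hτ hσ).faceOf (Sum.inl g') ↔ τ.SameCycle g g' := by
  rw [faceOf_eq_iff]
  simp only [SameCycle, facePerm_zpow_inl, Sum.inl.injEq]

theorem faceOf_inr_eq_iff {g g' : Out} : (ofPerms D τ σ hτ hσ).faceOf (Sum.inr (D.mate g)) =
    (ofPerms D τ σ hτ hσ).faceOf (Sum.inr (D.mate g')) ↔ (σ * τ).SameCycle g g' := by
  rw [faceOf_eq_iff, ← sameCycle_inv (f := σ * τ)]
  simp only [SameCycle, facePerm_zpow_inr, Sum.inr.injEq, D.mate.injective.eq_iff]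

theorem faceOf_inl_ne_inr {g g' : Out} : (ofPerms D τ σ hτ hσ).faceOf (Sum.inl g) ≠
    (ofPerms D τ σ hτ hσ).faceOf (Sum.inr (D.mate g')) := by
  rw [Ne, faceOf_eq_iff]
  rintro ⟨n, hn⟩
  rw [facePerm_zpow_inl] at hn
  cases hn

theorem boundedClockwise_ofPerms (hall : ∀ g g', τ.SameCycle g g') {T : Cycle Out}
    (hT : D.IsDirectedEulerCircuit T) (hTτ : T.Chain fun g g' => τ g = g') (g : Out) :
    (ofPerms D τ σ hτ hσ).BoundedClockwise ((ofPerms D τ σ hτ hσ).faceOf (Sum.inl g)) T := by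
  refine ⟨hT.1, nodup_map_of_injective hT.2.1 Sum.inl_injective, ?_, ?_⟩
  · rw [Cycle.chain_map]
    refine hTτ.imp fun a b hab => ?_
    have := facePerm_zpow_inl hτ hσ 1 a
    rw [← hab]
    simpa using this
  · rintro (g' | h')
    · rw [faceOf_inl_eq_iff, Cycle.mem_map]
      exact ⟨fun _ => hall _ _, fun _ => ⟨g', hT.2.2.1 g', rfl⟩⟩
    · obtain ⟨g', rfl⟩ := D.mate.surjective h'
      simp only [Cycle.mem_map, reduceCtorEq, and_false, exists_false, false_iff]
      exact (faceOf_inl_ne_inr hτ hσ).symm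

variable [Finite Out]

/-- The orbit is reversed because face tracing follows the inverse of `σ * τ`, while the directed
walk follows `σ * τ` itself: `σ` preserves tails, so `στ` sends an arc to one leaving its head. -/
theorem boundedAnticlockwise_ofPerms (g : Out) : (ofPerms D τ σ hτ hσ).BoundedAnticlockwise
    ((ofPerms D τ σ hτ hσ).faceOf (Sum.inr (D.mate g)))
    (Function.periodicOrbit ((σ * τ)⁻¹ : Perm Out) g).reverse := by
  have hσt : ∀ g, D.tail (σ g) = D.tail g := fun g => ((hσ g (σ g)).1 ⟨1, by simp⟩).symm
  have hrev : ((Function.periodicOrbit ((σ * τ)⁻¹ : Perm Out) g).reverse.map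
      fun g => (Sum.inr (D.mate g) : Out ⊕ In)).reverse =
      (Function.periodicOrbit ((σ * τ)⁻¹ : Perm Out) g).map fun g => Sum.inr (D.mate g) := by
    induction Function.periodicOrbit ((σ * τ)⁻¹ : Perm Out) g using Quotient.inductionOn with
    | _ l =>
      change ((((l : Cycle Out).reverse).map _).reverse : Cycle (Out ⊕ In)) = (l : Cycle Out).map _
      simp
  have hinj : Function.Injective fun g => (Sum.inr (D.mate g) : Out ⊕ In) :=
    Sum.inr_injective.comp D.mate.injective
  refine ⟨⟨?_, ?_⟩, ?_⟩
  · intro h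
    have h1 : g ∈ (Function.periodicOrbit ((σ * τ)⁻¹ : Perm Out) g).reverse :=
      Cycle.mem_reverse_iff.2 (mem_periodicOrbit_iff_sameCycle.2 (SameCycle.refl _ _))
    rw [h] at h1
    exact Cycle.notMem_nil _ h1
  · rw [chain_reverse_iff]
    refine chain_periodicOrbit fun a => ?_
    have e : σ (τ ((σ * τ)⁻¹ a)) = a := (σ * τ).apply_symm_apply a
    rw [hτ, ← hσt, e]
  · rw [hrev]
    refine ⟨nodup_map_of_injective Function.nodup_periodicOrbit hinj, ?_, ?_⟩
    · rw [Cycle.chain_map]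
      refine chain_periodicOrbit fun a => ?_
      have := facePerm_zpow_inr hτ hσ 1 a
      simpa using this
    · rintro (g' | h')
      · simp only [Cycle.mem_map, reduceCtorEq, and_false, exists_false, false_iff]
        exact faceOf_inl_ne_inr hτ hσ
      · obtain ⟨g', rfl⟩ := D.mate.surjective h'
        rw [faceOf_inr_eq_iff, sameCycle_comm, ← sameCycle_inv, Cycle.mem_map]
        constructor
        · rintro ⟨a, ha, e⟩
          rw [← hinj e]
          exact mem_periodicOrbit_iff_sameCycle.1 ha
        · intro h
          exact ⟨g', mem_periodicOrbit_iff_sameCycle.2 h, rfl⟩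

theorem isAntiface_iff (hall : ∀ g g', τ.SameCycle g g') (g : Out)
    (f : (ofPerms D τ σ hτ hσ).Face) :
    (ofPerms D τ σ hτ hσ).IsAntiface f ↔ f ≠ (ofPerms D τ σ hτ hσ).faceOf (Sum.inl g) := by
  constructor
  · rintro ⟨C, ⟨hC, -⟩, -, -, h3⟩ rfl
    have h1 := (h3 (Sum.inl g)).2 rfl
    rw [Cycle.mem_reverse_iff, Cycle.mem_map] at h1
    obtain ⟨_, -, h1⟩ := h1
    cases h1
  · induction f using Quotient.inductionOn with
    | _ h =>
      intro hne
      rcases h with g' | h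
      · exact (hne ((faceOf_inl_eq_iff hτ hσ).2 (hall g' g))).elim
      · obtain ⟨g', rfl⟩ := D.mate.surjective h
        exact ⟨_, boundedAnticlockwise_ofPerms hτ hσ g'⟩

theorem card_antiface : Nat.card {f // (ofPerms D τ σ hτ hσ).IsAntiface f} =
    numCycles (σ * τ) := by
  refine (Nat.card_eq_of_bijective (Quotient.lift (s := SameCycle.setoid (σ * τ))
    (fun g => (⟨(ofPerms D τ σ hτ hσ).faceOf (Sum.inr (D.mate g)), _,
      boundedAnticlockwise_ofPerms hτ hσ g⟩ : {f // (ofPerms D τ σ hτ hσ).IsAntiface f}))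
    fun a b hab => Subtype.ext ((faceOf_inr_eq_iff hτ hσ).2 hab)) ⟨?_, ?_⟩).symm
  · rintro ⟨a⟩ ⟨b⟩ hab
    exact Quotient.sound ((faceOf_inr_eq_iff hτ hσ).1 (Subtype.ext_iff.1 hab))
  · rintro ⟨f, C, ⟨hC, -⟩, -, -, h3⟩
    obtain ⟨g, hg⟩ : ∃ g, g ∈ C := by
      induction C using Quotient.inductionOn with
      | _ l =>
        cases l with
        | nil => exact (hC rfl).elim
        | cons a l => exact ⟨a, List.mem_cons_self⟩
    refine ⟨Quotient.mk _ g, Subtype.ext ?_⟩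
    refine (h3 (Sum.inr (D.mate g))).1 ?_
    rw [Cycle.mem_reverse_iff, Cycle.mem_map]
    exact ⟨g, hg, rfl⟩

theorem card_face_ofPerms [Finite In] (hall : ∀ g g', τ.SameCycle g g') (g : Out) :
    Nat.card (ofPerms D τ σ hτ hσ).Face = numCycles (σ * τ) + 1 := by
  have : Finite (ofPerms D τ σ hτ hσ).Face := Quotient.finite _
  have := Fintype.ofFinite (ofPerms D τ σ hτ hσ).Face
  classical
  rw [← card_antiface hτ hσ,
    Nat.card_congr (Equiv.subtypeEquivRight (isAntiface_iff hτ hσ hall g)),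
    Nat.card_eq_fintype_card, Nat.card_eq_fintype_card, Fintype.card_subtype_compl]
  have : 0 < Fintype.card (ofPerms D τ σ hτ hσ).Face :=
    Fintype.card_pos_iff.2 ⟨(ofPerms D τ σ hτ hσ).faceOf (Sum.inl g)⟩
  simp
  omega

end OfPerms

end OrientedEmbedding

end HalfArcDigraph

/-! ### The main theorem -/

open HalfArcDigraph HalfArcDigraph.OrientedEmbedding PermCycles

theorem corollary4p2 {V Out In : Type*} [Fintype V] [Finite Out] [Finite In]
    (D : HalfArcDigraph V Out In) [DecidableRel D.underlyingSimpleGraph.Adj]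
    (hδ : (4 * (Nat.card V : ℚ) + 2) / 5 ≤ (D.underlyingSimpleGraph.minDegree : ℚ))
    (T : Cycle Out) (hT : D.IsDirectedEulerCircuit T) :
    ∃ Φ : D.OrientedEmbedding,
      Φ.IsDirected ∧
      (∃ f : Φ.Face, Φ.BoundedClockwise f T ∧ ∀ f' : Φ.Face, Φ.IsProface f' → f' = f) ∧
      (Even (Nat.card V + Nat.card Out) → Nat.card {f : Φ.Face // Φ.IsAntiface f} = 1) ∧
      (Odd (Nat.card V + Nat.card Out) → Nat.card {f : Φ.Face // Φ.IsAntiface f} = 2) ∧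
      (∀ Φ' : D.OrientedEmbedding, Φ'.IsDirected → Φ'.genus ≤ Φ.genus) ∧
      (Even (Nat.card V + Nat.card Out) →
        Φ.IsBiEulerian ∧ ∃ f : Φ.Face, Φ.BoundedBy f T) := by
  classical
  have := Fintype.ofFinite Out
  obtain ⟨l, rfl⟩ : ∃ l : List Out, T = l := ⟨_, (Quotient.out_eq T).symm⟩
  have hl : l.Nodup := Cycle.nodup_coe_iff.1 hT.2.1
  have hmem : ∀ g, g ∈ l := fun g => Cycle.mem_coe_iff.1 (hT.2.2.1 g)
  have hsurj : Function.Surjective D.tail := fun v => by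
    obtain ⟨g, -, hg⟩ := hT.2.2.2 v
    exact ⟨g, hg⟩
  obtain ⟨g₀⟩ : Nonempty Out := by
    obtain ⟨g, hg⟩ := List.exists_mem_of_ne_nil l fun h => hT.1.1 (by rw [h]; rfl)
    exact ⟨g⟩
  have : Nonempty Out := ⟨g₀⟩
  have hτ : ∀ g, D.head g = D.tail (l.formPerm g) := fun g =>
    (chain_iff_formPerm hl).1 hT.1.2 g (hmem g)
  have hTτ : (l : Cycle Out).Chain fun g g' => l.formPerm g = g' :=
    (chain_iff_formPerm hl).2 fun _ _ => rfl
  have hall : ∀ g g', l.formPerm.SameCycle g g' :=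
    fun g g' => sameCycle_formPerm hl (hmem g) (hmem g')
  obtain ⟨s, hs, hnum⟩ := exists_fiberPerm_numCycles (lab := D.tail) hl hmem hsurj
    D.underlyingSimpleGraph (by
      intro u v huv
      rcases huv.2 with ⟨g, h1, h2⟩ | ⟨g, h1, h2⟩
      · exact ⟨g, Or.inl ⟨h1, (hτ g).symm.trans h2⟩⟩
      · exact ⟨g, Or.inr ⟨h1, (hτ g).symm.trans h2⟩⟩) (by
      intro v
      have h1 := D.underlyingSimpleGraph.minDegree_le_degree v
      rw [div_le_iff₀ (by norm_num), Nat.card_eq_fintype_card] at hδ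
      have h2 : 4 * Fintype.card V + 2 ≤ D.underlyingSimpleGraph.minDegree * 5 := by
        exact_mod_cast hδ
      omega)
  have hσ : ∀ g g', (fiberPerm D.tail s).SameCycle g g' ↔ D.tail g = D.tail g' := by
    intro g g'
    constructor
    · intro h
      obtain ⟨n, rfl⟩ := h.exists_nat_pow_eq
      rw [← map_pow, lab_fiberPerm D.tail]
    · intro h
      exact (sameCycle_fiberPerm_iff D.tail s ⟨g, rfl⟩ ⟨g', h.symm⟩).2 (hs _ _ _)
  generalize fiberPerm D.tail s = σ at hσ hnum
  -- Here `τ` has one cycle and `σ` has one per vertex, so the parity of `|V| + |A|` decides between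
  -- one and two antifaces.
  have hparity := even_numCycles_mul σ l.formPerm
  rw [numCycles_eq_one hall, numCycles_eq_card hσ hsurj] at hparity
  have hclock := boundedClockwise_ofPerms hτ hσ hall hT hTτ g₀
  have hface := card_face_ofPerms hτ hσ hall g₀
  have hanti := card_antiface hτ hσ
  have hinc : Function.Surjective D.inc := fun v => by
    obtain ⟨g, hg⟩ := hsurj v
    exact ⟨Sum.inl g, hg⟩
  have hfaces : ∀ f, f = (ofPerms D l.formPerm σ hτ hσ).faceOf (Sum.inl g₀) ∨
      ∃ g, f = (ofPerms D l.formPerm σ hτ hσ).faceOf (Sum.inr (D.mate g)) := by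
    intro f
    by_cases h : f = (ofPerms D l.formPerm σ hτ hσ).faceOf (Sum.inl g₀)
    · exact Or.inl h
    · obtain ⟨h', rfl⟩ : ∃ h', (ofPerms D l.formPerm σ hτ hσ).faceOf h' = f := Quotient.exists_rep f
      rcases h' with g | h'
      · exact (h ((faceOf_inl_eq_iff hτ hσ).2 (hall _ _))).elim
      · obtain ⟨g, rfl⟩ := D.mate.surjective h'
        exact Or.inr ⟨g, rfl⟩
  refine ⟨ofPerms D l.formPerm σ hτ hσ, ?_, ⟨_, hclock, ?_⟩, ?_, ?_, ?_, ?_⟩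
  · intro f
    rcases hfaces f with rfl | ⟨g, rfl⟩
    · exact ⟨_, Or.inl hclock⟩
    · exact ⟨_, Or.inr (boundedAnticlockwise_ofPerms hτ hσ g)⟩
  · rintro f ⟨C, hC⟩
    rcases hfaces f with rfl | ⟨g, rfl⟩
    · rfl
    · have h1 := (hC.2.2.2 _).2 rfl
      rw [Cycle.mem_map] at h1
      obtain ⟨_, -, h1⟩ := h1
      cases h1
  · intro h
    rw [hanti]
    rw [Nat.even_iff] at h hparity
    omega
  · intro h
    rw [hanti]
    rw [Nat.odd_iff] at h
    rw [Nat.even_iff] at hparity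
    omega
  · intro Φ' hΦ'
    have h1 := Φ'.even_card_face hinc
    have h2 := (ofPerms D l.formPerm σ hτ hσ).even_card_face hinc
    have h3 := Φ'.two_le_card_face hΦ'
    -- The constructed embedding has two or three faces, any directed one has at least two, and the
    -- parities agree.
    have h4 : Nat.card (ofPerms D l.formPerm σ hτ hσ).Face ≤ Nat.card Φ'.Face := by
      rw [Nat.even_iff] at h1 h2
      omega
    have h5 : (Nat.card (ofPerms D l.formPerm σ hτ hσ).Face : ℚ) ≤ Nat.card Φ'.Face := by
      exact_mod_cast h4
    unfold genus
    linarith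
  · intro h
    have h1 : numCycles (σ * l.formPerm) = 1 := by
      rw [Nat.even_iff] at h hparity
      omega
    refine ⟨⟨by rw [hface, h1], fun f => ?_⟩, _, Or.inl hclock⟩
    rcases hfaces f with rfl | ⟨g, rfl⟩
    · exact ⟨_, hT, Or.inl hclock⟩
    · have hbd := boundedAnticlockwise_ofPerms hτ hσ g
      have hin : ∀ g', g' ∈ (Function.periodicOrbit ((σ * l.formPerm)⁻¹ : Perm Out) g).reverse := by
        intro g'
        rw [Cycle.mem_reverse_iff, mem_periodicOrbit_iff_sameCycle, sameCycle_inv]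
        exact sameCycle_of_numCycles_le_one h1.le _ _
      refine ⟨_, ⟨hbd.1, Cycle.nodup_reverse_iff.2 Function.nodup_periodicOrbit, hin, fun v => ?_⟩,
        Or.inr hbd⟩
      obtain ⟨g', hg'⟩ := hsurj v
      exact ⟨g', hin g', hg'⟩
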